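/- Let $R$ be an integral domain (commutative, with $1\neq 0$), let $R^\times=R\setminus\{0\}$ be its multiplicative monoid of nonzero elements, $U(R)$ its group of units and $M(R)=R^\times/U(R)$. An isometric representation of $R$ on a Hilbert space consists of unitaries $U^n$ $(n\in R)$ and isometries $S_r$ $(r\in R^\times)$ with $S_rS_t=S_{rt}$, $U^nU^m=U^{n+m}$ and $S_rU^n=U^{rn}S_r$; let $A(R)$ be the norm closed operator algebra generated by unitaries $u^n$ and isometries $s_r$ which is universal for isometric representations of $R$. For a monoid $S$ acting on a compact Hausdorff space $X$ by continuous maps $\tau_s$ (with $\tau_s\circ\tau_t=\tau_{st}$ and $\tau_1=\mathrm{id}$), an isometric covariant representation consists of a unital $*$-representation $\pi$ of $C(X)$ and isometries $V_t$ $(t\in S)$ on a Hilbert space with $V_t\pi(f)=\pi(f\circ\tau_t)V_t$ and $V_sV_t=V_{ts}$ (which is $V_{st}$ if $S$ is commutative); let $C(X)\rtimes_\tau S$ be the norm closed operator algebra generated by $C(X)$ and the isometries of $S$ which is universal for isometric covariant representations. (1) There are a compact Hausdorff space $X$ and a monoid $S$ acting on $X$ by continuous maps such that $S$ embeds in an amenable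 group (for example, $S$ is commutative and cancellative, or free), $S$ has no invertible element other than $1$, and $A(R)$ is completely isometrically isomorphic to $C(X)\rtimes_\tau S$, if and only if $U(R)=\{1\}$. (2) If $U(R)=\{1\}$ and $R$ is not a field (equivalently, $R\not\cong\mathbb F_2$), then the monoid $M(R)$ is not finitely generated. -/

import Mathlib

open scoped ENNReal nonZeroDivisors

universe u

noncomputable section

namespace IntDomAlg

/-! ### Operator algebras acting on a family of Hilbert spaces

A family `(H i)` of nonzero Hilbert spaces gives the `C*`-algebra `∏ B(H i)` of all uniformly
bounded families of operators, which acts faithfully (diagonally) on the Hilbert space direct sum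
of the `H i`. Operator algebras are taken as norm closed subalgebras of it. -/

section Operators

variable {ι : Type*} (H : ι → Type u) [∀ i, NormedAddCommGroup (H i)]
  [∀ i, InnerProductSpace ℂ (H i)] [∀ i, Nontrivial (H i)]

/-- The `ℓ^∞`-product `∏ B(H i)`: uniformly bounded families of bounded operators, with
coordinatewise operations and the supremum norm. -/
abbrev BddOps : Type _ := lp (fun i => H i →L[ℂ] H i) ∞

variable {H}

/-- A matrix `(T j k)` of bounded operators on `K`, acting on the Hilbert space `K ⊕ ⋯ ⊕ K`
(`n` summands): `(T ξ) j = ∑ k, T j k (ξ k)`. -/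
def ampliation {K : Type u} [NormedAddCommGroup K] [InnerProductSpace ℂ K] {n : ℕ}
    (T : Matrix (Fin n) (Fin n) (K →L[ℂ] K)) :
    PiLp 2 (fun _ : Fin n => K) →L[ℂ] PiLp 2 (fun _ : Fin n => K) :=
  ((PiLp.continuousLinearEquiv 2 ℂ (fun _ : Fin n => K)).symm :
      (Fin n → K) →L[ℂ] PiLp 2 (fun _ : Fin n => K)) ∘L
    (ContinuousLinearMap.pi fun j => ∑ k, T j k ∘L ContinuousLinearMap.proj k) ∘L
    ((PiLp.continuousLinearEquiv 2 ℂ (fun _ : Fin n => K)) :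
      PiLp 2 (fun _ : Fin n => K) →L[ℂ] (Fin n → K))

/-- The operator norm of an `n × n` matrix over `∏ B(H i)`, i.e. its norm as an operator on the
`n`-fold sum of the direct sum of the `H i`. -/
def matrixNorm {n : ℕ} (a : Matrix (Fin n) (Fin n) (BddOps H)) : ℝ :=
  ⨆ i, ‖ampliation (fun j k => (a j k : ∀ i, H i →L[ℂ] H i) i)‖

end Operators

/-- Two operator algebras are completely isometrically isomorphic: there is an algebra isomorphism
all of whose matrix ampliations preserve the operator norm. -/
def CompletelyIsometricallyIsomorphic {ι κ : Type*} {H : ι → Type u} {K : κ → Type u}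
    [∀ i, NormedAddCommGroup (H i)] [∀ i, InnerProductSpace ℂ (H i)] [∀ i, Nontrivial (H i)]
    [∀ k, NormedAddCommGroup (K k)] [∀ k, InnerProductSpace ℂ (K k)] [∀ k, Nontrivial (K k)]
    (A : Subalgebra ℂ (BddOps H)) (B : Subalgebra ℂ (BddOps K)) : Prop :=
  ∃ Φ : A ≃ₐ[ℂ] B, ∀ (n : ℕ) (a : Matrix (Fin n) (Fin n) A),
    matrixNorm (fun j k => ((Φ (a j k) : B) : BddOps K)) =
      matrixNorm (fun j k => ((a j k : A) : BddOps H))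

/-! ### The universal operator algebra of an integral domain -/

/-- An isometric representation of the integral domain `R` on a (nonzero) Hilbert space `H`:
unitaries `U n` for `n ∈ R` and isometries `S r` for nonzero `r ∈ R` with `S r * S t = S (r * t)`,
`U n * U m = U (n + m)` and `S r * U n = U (r * n) * S r`. -/
structure IsometricRep (R : Type u) [CommRing R] where
  H : Type u
  [normedAddCommGroup : NormedAddCommGroup H]
  [innerProductSpace : InnerProductSpace ℂ H]
  [completeSpace : CompleteSpace H]
  [nontrivial : Nontrivial H]
  U : R → H →L[ℂ] H
  S : R⁰ → H →L[ℂ] H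
  U_mem_unitary : ∀ n, U n ∈ unitary (H →L[ℂ] H)
  S_isometry : ∀ r, Isometry (S r)
  S_mul : ∀ r t, S r * S t = S (r * t)
  U_add : ∀ n m, U n * U m = U (n + m)
  S_mul_U : ∀ r n, S r * U n = U ((r : R) * n) * S r

attribute [instance] IsometricRep.normedAddCommGroup IsometricRep.innerProductSpace
  IsometricRep.completeSpace IsometricRep.nontrivial

theorem norm_le_one_of_isometry {K : Type u} [NormedAddCommGroup K] [InnerProductSpace ℂ K]
    {T : K →L[ℂ] K} (hT : Isometry T) : ‖T‖ ≤ 1 :=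
  T.opNorm_le_bound zero_le_one fun x => by
    rw [one_mul, (AddMonoidHomClass.isometry_iff_norm T).1 hT x]

section Domain

variable (R : Type u) [CommRing R]

/-- The universal unitary `u^n`: the family of the unitaries `U n` of all isometric
representations. -/
def univU (n : R) : BddOps (fun ρ : IsometricRep R => ρ.H) :=
  ⟨fun ρ => ρ.U n, memℓp_infty ⟨1, by
    rintro _ ⟨ρ, rfl⟩
    exact (CStarRing.norm_of_mem_unitary (ρ.U_mem_unitary n)).le⟩⟩

/-- The universal isometry `s_r`: the family of the isometries `S r` of all isometric
representations. -/
def univS (r : R⁰) : BddOps (fun ρ : IsometricRep R => ρ.H) :=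
  ⟨fun ρ => ρ.S r, memℓp_infty ⟨1, by
    rintro _ ⟨ρ, rfl⟩
    exact norm_le_one_of_isometry (ρ.S_isometry r)⟩⟩

/-- `A(R)`: the norm closed operator algebra generated by the unitaries `u^n` and the isometries
`s_r` of the universal isometric representation, the direct sum of all isometric
representations of `R`. -/
def domainAlgebra : Subalgebra ℂ (BddOps (fun ρ : IsometricRep R => ρ.H)) :=
  (Algebra.adjoin ℂ (Set.range (univU R) ∪ Set.range (univS R))).topologicalClosure

/-- `M(R) = R^× / U(R)`: the multiplicative monoid of nonzero elements of the domain `R`, modulo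
its group of units. -/
abbrev unitQuotient : Type u := Associates R⁰

end Domain

/-! ### Semicrossed products by discrete monoids -/

section Semicrossed

variable (X S : Type u) [TopologicalSpace X] [CompactSpace X] [Monoid S]
  [MulAction S X] [ContinuousConstSMul S X]

variable {X S} in
/-- The continuous self map `τ_s : x ↦ s • x` of `X`; thus `τ_s ∘ τ_t = τ_{st}` and
`τ_1 = id`. -/
def actionMap (s : S) : C(X, X) := ⟨fun x => s • x, continuous_const_smul s⟩

/-- An isometric covariant representation of `(X, S, τ)` on a (nonzero) Hilbert space `H`: a
unital `*`-representation `π` of `C(X)` and isometries `V t` with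
`V t * π f = π (f ∘ τ_t) * V t`, multiplicative in `t`.

The order of the factors in `V s * V t = V (t * s)` is the one that covariance dictates, because
`V s * V t * π f = π (f ∘ τ_t ∘ τ_s) * V s * V t` and `τ_t ∘ τ_s = τ_{ts}`. It is also the one of
the isometries `e_s ↦ e_{st}` of `ℓ²(S)`. For commutative `S` it makes no difference. -/
structure CovariantRep where
  H : Type u
  [normedAddCommGroup : NormedAddCommGroup H]
  [innerProductSpace : InnerProductSpace ℂ H]
  [completeSpace : CompleteSpace H]
  [nontrivial : Nontrivial H]
  π : C(X, ℂ) →⋆ₐ[ℂ] (H →L[ℂ] H)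
  V : S → H →L[ℂ] H
  V_isometry : ∀ t, Isometry (V t)
  V_mul : ∀ s t, V s * V t = V (t * s)
  covariance : ∀ (t : S) (f : C(X, ℂ)), V t * π f = π (f.comp (actionMap t)) * V t

attribute [instance] CovariantRep.normedAddCommGroup CovariantRep.innerProductSpace
  CovariantRep.completeSpace CovariantRep.nontrivial

/-- The universal copy of `f ∈ C(X)`: the family of the operators `π f` of all isometric covariant
representations. -/
def univFun (f : C(X, ℂ)) : BddOps (fun ρ : CovariantRep X S => ρ.H) :=
  ⟨fun ρ => ρ.π f, memℓp_infty ⟨‖f‖, by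
    rintro _ ⟨ρ, rfl⟩
    exact NonUnitalStarAlgHom.norm_apply_le ρ.π f⟩⟩

/-- The universal isometry of `t ∈ S`: the family of the isometries `V t` of all isometric
covariant representations. -/
def univIsom (t : S) : BddOps (fun ρ : CovariantRep X S => ρ.H) :=
  ⟨fun ρ => ρ.V t, memℓp_infty ⟨1, by
    rintro _ ⟨ρ, rfl⟩
    exact norm_le_one_of_isometry (ρ.V_isometry t)⟩⟩

/-- The semicrossed product `C(X) ⋊_τ S`: the norm closed operator algebra generated by `C(X)` and
the isometries in the direct sum of all isometric covariant representations of `(X, S, τ)`. -/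
def semicrossedProduct : Subalgebra ℂ (BddOps (fun ρ : CovariantRep X S => ρ.H)) :=
  (Algebra.adjoin ℂ (Set.range (univFun X S) ∪ Set.range (univIsom X S))).topologicalClosure

end Semicrossed

/-! ### Monoids that embed in amenable groups -/

open scoped Classical in
/-- Amenability of a discrete group, as the Følner condition: for all finite `F ⊆ G` and `ε > 0`
there is a finite nonempty `K ⊆ G` with `|gK \ K| ≤ ε |K|` for all `g ∈ F`. -/
def IsAmenableGroup (G : Type u) [Group G] : Prop :=
  ∀ (F : Finset G) (ε : ℝ), 0 < ε → ∃ K : Finset G, K.Nonempty ∧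
    ∀ g ∈ F, (((K.image fun x => g * x) \ K).card : ℝ) ≤ ε * (K.card : ℝ)

/-- `S` is isomorphic to a submonoid of an amenable group. -/
def EmbedsInAmenableGroup (S : Type u) [Monoid S] : Prop :=
  ∃ (G : Type u) (_ : Group G) (j : S →* G), IsAmenableGroup G ∧ Function.Injective j

end IntDomAlg

end

open scoped Topology

set_option linter.unusedSectionVars false

/-! For every domain `R`, the algebra `A(R)` is itself a semicrossed product. A unitary
representation of `(R, +)` is the same as a representation of `C(X)`, with `X` the Pontryagin dual,
and the relation between `S r` and `U n` is covariance for `χ ↦ χ(r ·)`; so `S = R⁰` works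
(`completelyIsometricallyIsomorphic_additiveDual`). It embeds in the abelian, hence amenable, group
of units of the fraction field. Trivial units of `R` are needed only so that `S` has no invertible
element but `1`.

Conversely, consider invertible contractions with contractive inverse, a class that an isometric
isomorphism preserves. In a semicrossed product by a monoid `S ⊆ G` without nontrivial invertibles
they all commute (`commute_of_invertible_contractions`). Indeed, on `ℓ²(G; H)` such an element is a
block matrix supported on the pairs `(g, h)` with `h ∈ S g`. Its adjoint also comes from the
algebra, so `S ∩ S⁻¹ = {1}` leaves only the diagonal, and diagonal entries are limits of operators
`π f`. Amenability of `G` carries the vanishing of commutators from `ℓ²(G; H)` back to `H`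
(`apply_eq_zero_of_inflationComponent_single`). In `A(R)` the elements `u^1` and `s_x`, for a unit
`x`, are of this kind, and in the regular representation they commute only if `x = 1`.

Part (2) is Euclid's proof of the infinitude of primes. -/

namespace IntDomAlg

/-! ### Abelian groups are amenable -/

section Amenable

variable {G : Type u} [CommGroup G]

open scoped Classical in
/-- The products of powers, with exponents less than `N`, of the elements of `F`. -/
noncomputable def powerBox (F : Finset G) (N : ℕ) : Finset G :=
  (Fintype.piFinset fun _ : F => Finset.range N).image fun n => ∏ g : F, (g : G) ^ n g

theorem card_powerBox_le (F : Finset G) (N : ℕ) : (powerBox F N).card ≤ N ^ F.card := by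
  classical
  refine Finset.card_image_le.trans ?_
  simp

theorem powerBox_mono (F : Finset G) {M N : ℕ} (h : M ≤ N) : powerBox F M ⊆ powerBox F N := by
  classical
  refine Finset.image_subset_image (Fintype.piFinset_subset _ _ fun _ => ?_)
  exact Finset.range_mono h

theorem powerBox_one_nonempty (F : Finset G) : (powerBox F 1).Nonempty := by
  classical
  refine Finset.Nonempty.image ?_ _
  simp

theorem mul_mem_powerBox {F : Finset G} {N : ℕ} {g x : G} (hg : g ∈ F) (hx : x ∈ powerBox F N) :
    g * x ∈ powerBox F (N + 1) := by
  classical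
  obtain ⟨n, hn, rfl⟩ := Finset.mem_image.1 hx
  simp only [Fintype.mem_piFinset, Finset.mem_range] at hn
  refine Finset.mem_image.2 ⟨n + Pi.single (⟨g, hg⟩ : F) 1, ?_, ?_⟩
  · simp only [Fintype.mem_piFinset, Finset.mem_range, Pi.add_apply]
    intro a
    have := hn a
    have h1 : (Pi.single (⟨g, hg⟩ : F) 1 : F → ℕ) a ≤ 1 := by
      rw [Pi.single_apply]; split_ifs <;> simp
    omega
  · simp only [Pi.add_apply, pow_add, Finset.prod_mul_distrib]
    rw [mul_comm]
    congr 1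
    rw [Finset.prod_eq_single (⟨g, hg⟩ : F)]
    · simp
    · intro b _ hb
      simp [Pi.single_eq_of_ne hb]
    · simp

/-- Otherwise the boxes would grow geometrically, against the polynomial bound `N ^ F.card`. -/
theorem exists_card_powerBox_succ_le (F : Finset G) {ε : ℝ} (hε : 0 < ε) :
    ∃ N, 1 ≤ N ∧ ((powerBox F (N + 1)).card : ℝ) ≤ (1 + ε) * (powerBox F N).card := by
  by_contra! h
  have key : ∀ N : ℕ, (1 + ε) ^ N ≤ ((powerBox F (N + 1)).card : ℝ) := by
    intro N
    induction N with
    | zero => simpa using (powerBox_one_nonempty F).card_pos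
    | succ N ih =>
      rw [pow_succ']
      exact (mul_le_mul_of_nonneg_left ih (by positivity)).trans (h (N + 1) (by omega)).le
  have hlt : (fun n : ℕ => (n : ℝ) ^ F.card) =o[Filter.atTop] fun n : ℕ => (1 + ε) ^ n :=
    isLittleO_pow_const_const_pow_of_one_lt F.card (by linarith)
  -- The factor `1 + ε` absorbs the index shift in `key`, and the `2` makes the contradiction
  -- strict.
  have hc : (0 : ℝ) < 1 / (2 * (1 + ε)) := by positivity
  obtain ⟨N, hN, hN1⟩ := ((hlt.bound hc).and (Filter.eventually_ge_atTop 1)).exists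
  obtain ⟨M, rfl⟩ : ∃ M, N = M + 1 := ⟨N - 1, by omega⟩
  have h1 : ((powerBox F (M + 1)).card : ℝ) ≤ ((M + 1 : ℕ) : ℝ) ^ F.card := by
    exact_mod_cast card_powerBox_le F (M + 1)
  have h2 := key M
  rw [Real.norm_of_nonneg (by positivity), Real.norm_of_nonneg (by positivity), pow_succ] at hN
  have h3 : (0 : ℝ) < (1 + ε) ^ M := by positivity
  have h4 : 1 / (2 * (1 + ε)) * ((1 + ε) ^ M * (1 + ε)) = (1 + ε) ^ M / 2 := by
    field_simp
  linarith

theorem isAmenableGroup_of_commGroup : IsAmenableGroup G := by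
  classical
  intro F ε hε
  obtain ⟨N, hN, hcard⟩ := exists_card_powerBox_succ_le F hε
  refine ⟨powerBox F N, (powerBox_one_nonempty F).mono (powerBox_mono F hN), fun g hg => ?_⟩
  -- Multiplication by `g ∈ F` raises one exponent by one, so what leaves the box lies in the shell
  -- up to `N + 1`.
  have hsub : ((powerBox F N).image fun x => g * x) \ powerBox F N ⊆
      powerBox F (N + 1) \ powerBox F N := by
    refine Finset.sdiff_subset_sdiff ?_ le_rfl
    intro y hy
    obtain ⟨x, hx, rfl⟩ := Finset.mem_image.1 hy
    exact mul_mem_powerBox hg hx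
  have h1 := Finset.card_le_card hsub
  have h2 := Finset.card_sdiff_add_card_eq_card (powerBox_mono F (Nat.le_succ N))
  have h3 : ((((powerBox F N).image fun x => g * x) \ powerBox F N).card : ℝ) +
      (powerBox F N).card ≤ (powerBox F (N + 1)).card := by
    exact_mod_cast (by simp only [Nat.succ_eq_add_one] at h2; omega)
  convert (by linarith : ((((powerBox F N).image fun x => g * x) \ powerBox F N).card : ℝ) ≤
    ε * (powerBox F N).card)

end Amenable

/-! ### The multiplicative monoid of a domain -/

theorem embedsInAmenableGroup_nonZeroDivisors (R : Type u) [CommRing R] [IsDomain R] :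
    EmbedsInAmenableGroup R⁰ := by
  refine ⟨(FractionRing R)ˣ, inferInstance,
    { toFun := fun r => Units.mk0 (algebraMap R (FractionRing R) r) <|
        IsFractionRing.to_map_ne_zero_of_mem_nonZeroDivisors r.2
      map_one' := Units.ext (by simp)
      map_mul' := fun a b => Units.ext (by simp) }, isAmenableGroup_of_commGroup, ?_⟩
  intro a b h
  exact Subtype.ext (IsFractionRing.injective R (FractionRing R) (congrArg Units.val h))

/-- Euclid's argument: if `1` is the only unit and `p` is the product of finitely many generators,
then `1 + p` has no generator as a divisor. -/
theorem not_fg_unitQuotient (R : Type u) [CommRing R] [IsDomain R]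
    (hU : ∀ x : R, IsUnit x → x = 1) (hR : ¬ IsField R) : ¬ Monoid.FG (unitQuotient R) := by
  classical
  rintro ⟨T, hT⟩
  obtain ⟨f, hf⟩ : ∃ f : Associates R⁰ → R⁰, ∀ a, Associates.mk (f a) = a :=
    ⟨Quot.out, fun a => Quot.out_eq a⟩
  have hinj : ∀ a b : R⁰, Associates.mk a = Associates.mk b → a = b := by
    intro a b h
    obtain ⟨c, hc⟩ := Associates.mk_eq_mk_iff_associated.1 h
    have h1 : ((c : R⁰) : R) = 1 := hU _ (c.isUnit.map R⁰.subtype)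
    have h2 : (c : R⁰) = 1 := Subtype.ext h1
    rw [← hc, h2, mul_one]
  have hf1 : ∀ a, f a = 1 → a = 1 := fun a ha => by rw [← hf a, ha]; rfl
  have hdvd : ∀ a : Associates R⁰, a ≠ 1 → ∃ t ∈ T, t ≠ 1 ∧ t ∣ a := by
    intro a
    have ha : a ∈ Submonoid.closure (T : Set (Associates R⁰)) := hT ▸ Submonoid.mem_top a
    induction ha using Submonoid.closure_induction with
    | mem x hx => exact fun h => ⟨x, hx, h, dvd_rfl⟩
    | one => exact fun h => (h rfl).elim
    | mul x y _ _ hx hy =>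
      intro h
      by_cases h1 : x = 1
      · subst h1
        obtain ⟨t, ht, ht1, htd⟩ := hy (by simpa using h)
        exact ⟨t, ht, ht1, by simpa using htd⟩
      · obtain ⟨t, ht, ht1, htd⟩ := hx h1
        exact ⟨t, ht, ht1, htd.mul_right y⟩
  set p : R⁰ := ∏ t ∈ T.erase 1, f t with hp
  have hpdvd : ∀ t ∈ T, t ≠ 1 → ((f t : R⁰) : R) ∣ (p : R) := fun t ht h1 =>
    map_dvd R⁰.subtype (Finset.dvd_prod_of_mem f (Finset.mem_erase.2 ⟨h1, ht⟩))
  have hunit : ∀ t ∈ T, t ≠ 1 → ¬ IsUnit ((f t : R⁰) : R) := fun t _ h1 h =>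
    h1 (hf1 t (Subtype.ext (hU _ h)))
  have hp0 : (p : R) ≠ 0 := nonZeroDivisors.ne_zero p.2
  -- Euclid's number may vanish. Then `p = -1` is a unit, so there are no nontrivial generators, `1`
  -- is the only nonzero element and `R` is a field.
  by_cases h0 : (1 + p : R) = 0
  · have hpu : IsUnit (p : R) := by
      rw [show (p : R) = -1 by linear_combination h0]
      exact isUnit_one.neg
    apply hR
    refine ⟨exists_pair_ne R, mul_comm, fun {a} ha => ⟨1, ?_⟩⟩
    rw [mul_one]
    by_contra ha1
    have hne : Associates.mk (⟨a, mem_nonZeroDivisors_of_ne_zero ha⟩ : R⁰) ≠ 1 := by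
      intro h
      exact ha1 (congrArg Subtype.val (hinj _ 1 h))
    obtain ⟨t, ht, ht1, -⟩ := hdvd _ hne
    exact hunit t ht ht1 (isUnit_of_dvd_unit (hpdvd t ht ht1) hpu)
  · have hne : Associates.mk (⟨1 + p, mem_nonZeroDivisors_of_ne_zero h0⟩ : R⁰) ≠ 1 := by
      intro h
      have := congrArg Subtype.val (hinj _ 1 h)
      simp only [Submonoid.coe_one, add_eq_left] at this
      exact hp0 this
    obtain ⟨t, ht, ht1, htd⟩ := hdvd _ hne
    rw [← hf t, Associates.mk_dvd_mk] at htd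
    have h2 : ((f t : R⁰) : R) ∣ 1 + p := map_dvd R⁰.subtype htd
    exact hunit t ht ht1 (isUnit_of_dvd_one ((dvd_add_left (hpdvd t ht ht1)).1 h2))

/-! ### Permutations with an operator coefficient on `ℓ²(ι; H)` -/

section WeightedPerm

variable {ι : Type*} {H : Type*} [NormedAddCommGroup H] [InnerProductSpace ℂ H]

theorem memℓp_comp_perm (e : Equiv.Perm ι) (T : H →L[ℂ] H) (ξ : lp (fun _ : ι => H) 2) :
    Memℓp (fun i => T (ξ (e i))) 2 := by
  have h2 : 0 < (2 : ℝ≥0∞).toReal := by norm_num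
  have hs : Summable fun i => ‖ξ (e i)‖ ^ (2 : ℝ≥0∞).toReal :=
    ((lp.memℓp ξ).summable h2).comp_injective e.injective
  refine memℓp_gen ((hs.mul_left (‖T‖ ^ (2 : ℝ≥0∞).toReal)).of_nonneg_of_le
    (fun i => by positivity) fun i => ?_)
  rw [← Real.mul_rpow (norm_nonneg _) (norm_nonneg _)]
  exact Real.rpow_le_rpow (norm_nonneg _) (T.le_opNorm _) h2.le

/-- The operator `(ξ i)_i ↦ (T (ξ (e i)))_i` on `ℓ²(ι; H)`. -/
noncomputable def weightedPerm (e : Equiv.Perm ι) (T : H →L[ℂ] H) :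
    lp (fun _ : ι => H) 2 →L[ℂ] lp (fun _ : ι => H) 2 :=
  LinearMap.mkContinuous
    { toFun := fun ξ => ⟨fun i => T (ξ (e i)), memℓp_comp_perm e T ξ⟩
      map_add' := fun ξ η => lp.ext <| funext fun i => by
        simp only [lp.coeFn_add, Pi.add_apply]
        exact map_add T _ _
      map_smul' := fun c ξ => lp.ext <| funext fun i => by
        simp only [lp.coeFn_smul, Pi.smul_apply, RingHom.id_apply]
        exact map_smul T c _ } ‖T‖ fun ξ => by
    have h2 : 0 < (2 : ℝ≥0∞).toReal := by norm_num
    refine lp.norm_le_of_forall_sum_le h2 (by positivity) fun s => ?_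
    have h := lp.sum_rpow_le_norm_rpow h2 ξ (s.map e.toEmbedding)
    rw [Finset.sum_map] at h
    rw [Real.mul_rpow (norm_nonneg _) (norm_nonneg _)]
    refine le_trans ?_ (mul_le_mul_of_nonneg_left h (by positivity))
    rw [Finset.mul_sum]
    refine Finset.sum_le_sum fun i _ => ?_
    rw [← Real.mul_rpow (norm_nonneg _) (norm_nonneg _)]
    exact Real.rpow_le_rpow (norm_nonneg _) (T.le_opNorm _) h2.le

@[simp]
theorem weightedPerm_apply (e : Equiv.Perm ι) (T : H →L[ℂ] H) (ξ : lp (fun _ : ι => H) 2) (i : ι) :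
    weightedPerm e T ξ i = T (ξ (e i)) := rfl

/-- Permutations act by precomposition, hence multiply in reverse order. This matches the rule `V s
* V t = V (t * s)`. -/
theorem weightedPerm_mul (e e' : Equiv.Perm ι) (T T' : H →L[ℂ] H) :
    weightedPerm e T * weightedPerm e' T' = weightedPerm (e' * e) (T * T') := rfl

theorem weightedPerm_one : weightedPerm (1 : Equiv.Perm ι) (1 : H →L[ℂ] H) = 1 := rfl

theorem weightedPerm_add (e : Equiv.Perm ι) (T T' : H →L[ℂ] H) :
    weightedPerm e (T + T') = weightedPerm e T + weightedPerm e T' := rfl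

theorem weightedPerm_smul (e : Equiv.Perm ι) (c : ℂ) (T : H →L[ℂ] H) :
    weightedPerm e (c • T) = c • weightedPerm e T := rfl

theorem weightedPerm_isometry (e : Equiv.Perm ι) {T : H →L[ℂ] H} (hT : Isometry T) :
    Isometry (weightedPerm e T) := by
  rw [AddMonoidHomClass.isometry_iff_norm] at hT ⊢
  intro ξ
  have h2 : 0 < (2 : ℝ≥0∞).toReal := by norm_num
  rw [lp.norm_eq_tsum_rpow h2, lp.norm_eq_tsum_rpow h2]
  simp only [weightedPerm_apply, hT]
  rw [e.tsum_eq fun i => ‖ξ i‖ ^ (2 : ℝ≥0∞).toReal]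

theorem weightedPerm_star [CompleteSpace H] (e : Equiv.Perm ι) (T : H →L[ℂ] H) :
    star (weightedPerm e T) = weightedPerm e⁻¹ (star T) := by
  symm
  refine (ContinuousLinearMap.eq_adjoint_iff _ _).2 ?_
  intro ξ η
  rw [lp.inner_eq_tsum, lp.inner_eq_tsum, ← e.tsum_eq]
  refine tsum_congr fun i => ?_
  simp only [weightedPerm_apply, Equiv.Perm.inv_def, Equiv.symm_apply_apply]
  rw [ContinuousLinearMap.star_eq_adjoint, ContinuousLinearMap.adjoint_inner_left]

theorem weightedPerm_mem_unitary [CompleteSpace H] (e : Equiv.Perm ι) :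
    weightedPerm e (1 : H →L[ℂ] H) ∈ unitary (lp (fun _ : ι => H) 2 →L[ℂ] _) := by
  rw [Unitary.mem_iff, weightedPerm_star, weightedPerm_mul, weightedPerm_mul, star_one, mul_one,
    mul_inv_cancel, inv_mul_cancel]
  exact ⟨weightedPerm_one, weightedPerm_one⟩

instance [Nonempty ι] [Nontrivial H] : Nontrivial (lp (fun _ : ι => H) 2) := by
  classical
  obtain ⟨i⟩ := ‹Nonempty ι›
  exact (lp.isometry_single (p := 2) (E := fun _ : ι => H) i).injective.nontrivial

end WeightedPerm

/-! ### Normed space structure of `∏ B(H i)` -/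

section Instances

variable {ι : Type*} (H : ι → Type u) [∀ i, NormedAddCommGroup (H i)]
  [∀ i, InnerProductSpace ℂ (H i)]

noncomputable instance BddOps.instNormedAddCommGroup : NormedAddCommGroup (BddOps H) :=
  lp.normedAddCommGroup

noncomputable instance BddOps.instSeminormedAddCommGroup : SeminormedAddCommGroup (BddOps H) :=
  NormedAddCommGroup.toSeminormedAddCommGroup

noncomputable instance BddOps.instNormedSpace : NormedSpace ℂ (BddOps H) :=
  lp.instNormedSpace

noncomputable instance BddOps.instTopologicalSpace : TopologicalSpace (BddOps H) :=
  UniformSpace.toTopologicalSpace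

instance BddOps.instT2Space : T2Space (BddOps H) :=
  T25Space.t2Space

noncomputable instance BddOps.instAddCommGroup : AddCommGroup (BddOps H) :=
  NormedAddCommGroup.toAddCommGroup

noncomputable instance BddOps.instAddCommMonoid : AddCommMonoid (BddOps H) :=
  AddCommGroup.toAddCommMonoid

noncomputable instance BddOps.instModule : Module ℂ (BddOps H) :=
  NormedSpace.toModule

end Instances

/-! ### Matrix norms and restriction of families -/

section MatrixNorm

variable {ι : Type*} {H : ι → Type u} [∀ i, NormedAddCommGroup (H i)]
  [∀ i, InnerProductSpace ℂ (H i)]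

theorem ampliation_apply {K : Type u} [NormedAddCommGroup K] [InnerProductSpace ℂ K] {n : ℕ}
    (T : Matrix (Fin n) (Fin n) (K →L[ℂ] K)) (ξ : PiLp 2 (fun _ : Fin n => K)) (j : Fin n) :
    ampliation T ξ j = ∑ k, T j k (ξ k) := by
  simp [ampliation]

theorem norm_ampliation_le {K : Type u} [NormedAddCommGroup K] [InnerProductSpace ℂ K] {n : ℕ}
    (T : Matrix (Fin n) (Fin n) (K →L[ℂ] K)) : ‖ampliation T‖ ≤ ∑ j, ∑ k, ‖T j k‖ := by
  classical
  refine ContinuousLinearMap.opNorm_le_bound _ (by positivity) fun ξ => ?_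
  have h1 : ampliation T ξ = ∑ j, PiLp.single 2 j (ampliation T ξ j) := by
    ext i
    simp [Pi.single_apply]
  rw [h1, Finset.sum_mul]
  refine (norm_sum_le _ _).trans (Finset.sum_le_sum fun j _ => ?_)
  rw [PiLp.norm_single, ampliation_apply, Finset.sum_mul]
  refine (norm_sum_le _ _).trans (Finset.sum_le_sum fun k _ => ?_)
  exact (T j k).le_of_opNorm_le_of_le le_rfl (PiLp.norm_apply_le ξ k)

theorem norm_le_norm_ampliation {K : Type u} [NormedAddCommGroup K] [InnerProductSpace ℂ K] {n : ℕ}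
    (T : Matrix (Fin n) (Fin n) (K →L[ℂ] K)) (j k : Fin n) : ‖T j k‖ ≤ ‖ampliation T‖ := by
  classical
  refine ContinuousLinearMap.opNorm_le_bound _ (by positivity) fun x => ?_
  have h1 : T j k x = ampliation T (PiLp.single 2 k x) j := by
    rw [ampliation_apply, Finset.sum_eq_single k] <;> simp +contextual
  rw [h1, ← PiLp.norm_single (p := 2) (β := fun _ : Fin n => K) k x]
  exact (PiLp.norm_apply_le _ j).trans (ContinuousLinearMap.le_opNorm _ _)

/-- Needed because a real supremum over an unbounded set is `0` by convention. -/
theorem bddAbove_norm_ampliation {n : ℕ} (a : Matrix (Fin n) (Fin n) (BddOps H)) :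
    BddAbove (Set.range fun i => ‖ampliation (fun j k => (a j k : ∀ i, H i →L[ℂ] H i) i)‖) := by
  refine ⟨∑ j, ∑ k, ‖a j k‖, ?_⟩
  rintro _ ⟨i, rfl⟩
  refine (norm_ampliation_le _).trans ?_
  exact Finset.sum_le_sum fun j _ => Finset.sum_le_sum fun k _ =>
    lp.norm_apply_le_norm ENNReal.top_ne_zero _ _

theorem norm_apply_le_matrixNorm (a : BddOps H) (i : ι) :
    ‖(a : ∀ i, H i →L[ℂ] H i) i‖ ≤ matrixNorm (fun _ _ : Fin 1 => a) :=
  (norm_le_norm_ampliation (fun _ _ : Fin 1 => (a : ∀ i, H i →L[ℂ] H i) i) 0 0).trans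
    (le_ciSup (bddAbove_norm_ampliation fun _ _ : Fin 1 => a) i)

theorem matrixNorm_le_norm (a : BddOps H) : matrixNorm (fun _ _ : Fin 1 => a) ≤ ‖a‖ := by
  refine Real.iSup_le (fun i => (norm_ampliation_le _).trans ?_) (norm_nonneg _)
  simpa using lp.norm_apply_le_norm ENNReal.top_ne_zero a i

variable {κ : Type*} (F : κ → ι)

variable (H) in
/-- The restriction of a bounded family of operators along a map of index sets. -/
noncomputable def restrict : BddOps H →L[ℂ] BddOps (fun k => H (F k)) :=
  LinearMap.mkContinuous
    { toFun := fun a => ⟨fun k => (a : ∀ i, H i →L[ℂ] H i) (F k), memℓp_infty ⟨‖a‖, by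
        rintro _ ⟨k, rfl⟩
        exact lp.norm_apply_le_norm ENNReal.top_ne_zero a _⟩⟩
      map_add' := fun _ _ => rfl
      map_smul' := fun _ _ => rfl } 1 fun a => by
    rw [one_mul]
    exact lp.norm_le_of_forall_le (norm_nonneg _) fun k =>
      lp.norm_apply_le_norm ENNReal.top_ne_zero a _

theorem restrict_mul (a b : BddOps H) : restrict H F (a * b) = restrict H F a * restrict H F b := rfl

theorem restrict_one [∀ i, Nontrivial (H i)] : restrict H F (1 : BddOps H) = 1 := rfl

/-- The supremum on the left runs over a subfamily; it is `0` if the index type is empty. -/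
theorem matrixNorm_restrict_le {n : ℕ} (a : Matrix (Fin n) (Fin n) (BddOps H)) :
    matrixNorm (fun j k => restrict H F (a j k)) ≤ matrixNorm a :=
  Real.iSup_le (fun k => le_ciSup (bddAbove_norm_ampliation a) (F k))
    (Real.iSup_nonneg fun _ => ContinuousLinearMap.opNorm_nonneg _)

end MatrixNorm

/-! ### Monomials span the semicrossed product -/

section Generators

variable {X S : Type u} [TopologicalSpace X] [CompactSpace X] [Monoid S]
  [MulAction S X] [ContinuousConstSMul S X]

theorem CovariantRep.V_one (κ : CovariantRep X S) : κ.V 1 = 1 := by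
  ext x
  have h := κ.V_mul 1 1
  rw [mul_one] at h
  exact (κ.V_isometry 1).injective (DFunLike.congr_fun h x)

theorem univFun_one : univFun X S 1 = 1 := lp.ext <| funext fun κ => map_one κ.π

theorem univFun_mul (f g : C(X, ℂ)) : univFun X S (f * g) = univFun X S f * univFun X S g :=
  lp.ext <| funext fun κ => map_mul κ.π f g

theorem univIsom_one : univIsom X S 1 = 1 := lp.ext <| funext fun κ => κ.V_one

theorem univIsom_mul (s t : S) : univIsom X S s * univIsom X S t = univIsom X S (t * s) :=
  lp.ext <| funext fun κ => κ.V_mul s t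

theorem univIsom_mul_univFun (t : S) (f : C(X, ℂ)) :
    univIsom X S t * univFun X S f = univFun X S (f.comp (actionMap t)) * univIsom X S t :=
  lp.ext <| funext fun κ => κ.covariance t f

/-- Covariance moves functions to the left of isometries, so the monomials `f t` form a monoid and
their linear span is the generated algebra. Hence `P` need only be a closed subspace. -/
theorem semicrossedProduct_le {P : Submodule ℂ (BddOps (fun κ : CovariantRep X S => κ.H))}
    (hP : IsClosed (P : Set (BddOps (fun κ : CovariantRep X S => κ.H))))
    (h : ∀ f t, univFun X S f * univIsom X S t ∈ P) {b : BddOps (fun κ : CovariantRep X S => κ.H)}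
    (hb : b ∈ semicrossedProduct X S) : b ∈ P := by
  let M : Submonoid (BddOps (fun κ : CovariantRep X S => κ.H)) :=
    { carrier := Set.range fun p : C(X, ℂ) × S => univFun X S p.1 * univIsom X S p.2
      one_mem' := ⟨(1, 1), by simp only [univFun_one, univIsom_one, one_mul]⟩
      mul_mem' := by
        rintro _ _ ⟨⟨f, s⟩, rfl⟩ ⟨⟨g, t⟩, rfl⟩
        refine ⟨(f * g.comp (actionMap s), t * s), ?_⟩
        simp only [univFun_mul, ← univIsom_mul]
        rw [mul_assoc, mul_assoc, ← mul_assoc _ (univIsom X S s), ← univIsom_mul_univFun, mul_assoc] }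
  have hle : Set.range (univFun X S) ∪ Set.range (univIsom X S) ⊆ M := by
    rintro _ (⟨f, rfl⟩ | ⟨t, rfl⟩)
    · exact ⟨(f, 1), by simp only [univIsom_one, mul_one]⟩
    · exact ⟨(1, t), by simp only [univFun_one, one_mul]⟩
  have hadj : ∀ a ∈ Algebra.adjoin ℂ (Set.range (univFun X S) ∪ Set.range (univIsom X S)),
      a ∈ P := by
    intro a ha
    rw [← Subalgebra.mem_toSubmodule, Algebra.adjoin_eq_span] at ha
    refine (Submodule.span_le.2 ?_ : _ ≤ P) ha
    intro c hc
    obtain ⟨⟨f, t⟩, rfl⟩ := (Submonoid.closure_le.2 hle : _ ≤ M) hc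
    exact h f t
  exact closure_minimal (s := (Algebra.adjoin ℂ (Set.range (univFun X S) ∪
    Set.range (univIsom X S)) : Set (BddOps (fun κ : CovariantRep X S => κ.H)))) hadj hP hb

theorem semicrossedProduct_ext {E : Type*} [NormedAddCommGroup E] [NormedSpace ℂ E]
    {L L' : BddOps (fun κ : CovariantRep X S => κ.H) →L[ℂ] E}
    (h : ∀ f t, L (univFun X S f * univIsom X S t) = L' (univFun X S f * univIsom X S t))
    {b : BddOps (fun κ : CovariantRep X S => κ.H)} (hb : b ∈ semicrossedProduct X S) :
    L b = L' b :=
  semicrossedProduct_le (P :=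
    { carrier := {b | L b = L' b}
      add_mem' := fun {a b} (ha : L a = L' a) (hb : L b = L' b) => by
        change L (a + b) = L' (a + b)
        rw [map_add, map_add, ha, hb]
      zero_mem' := (map_zero L).trans (map_zero L').symm
      smul_mem' := fun c a (ha : L a = L' a) => by
        change L (c • a) = L' (c • a)
        rw [map_smul, map_smul, ha] })
    (isClosed_eq L.continuous L'.continuous) h hb

end Generators

/-! ### Inflation to `ℓ²(G; H)` and its block matrices -/

section Inflation

variable {X S : Type u} [TopologicalSpace X] [CompactSpace X] [Monoid S]
  [MulAction S X] [ContinuousConstSMul S X] {G : Type u} [Group G] (j : S →* G)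

/-- The covariant representation on `ℓ²(G; H)` which combines a covariant representation on `H`
with the left translations of `G`. -/
noncomputable def CovariantRep.inflation (κ : CovariantRep X S) : CovariantRep X S where
  H := lp (fun _ : G => κ.H) 2
  π :=
    { toFun := fun f => weightedPerm 1 (κ.π f)
      map_one' := by rw [map_one, weightedPerm_one]
      map_mul' := fun f g => by rw [map_mul, weightedPerm_mul, one_mul]
      map_zero' := by rw [map_zero]; rfl
      map_add' := fun f g => by rw [map_add, weightedPerm_add]
      commutes' := fun c => by
        rw [AlgHomClass.commutes, Algebra.algebraMap_eq_smul_one, weightedPerm_smul,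
          weightedPerm_one, Algebra.algebraMap_eq_smul_one]
      map_star' := fun f => by rw [map_star, weightedPerm_star, inv_one] }
  V := fun t => weightedPerm (Equiv.mulLeft (j t)) (κ.V t)
  V_isometry := fun t => weightedPerm_isometry _ (κ.V_isometry t)
  V_mul := fun s t => by
    rw [weightedPerm_mul, κ.V_mul, map_mul]
    congr 1
    ext g
    simp
  covariance := fun t f => by
    change weightedPerm _ _ * weightedPerm _ _ = weightedPerm _ _ * weightedPerm _ _
    rw [weightedPerm_mul, weightedPerm_mul, κ.covariance, one_mul, mul_one]

variable (κ : CovariantRep X S)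

/-- The component of a bounded family of operators at the inflation of `κ`. -/
noncomputable def inflationComponent :
    BddOps (fun κ : CovariantRep X S => κ.H) →L[ℂ]
      (lp (fun _ : G => κ.H) 2 →L[ℂ] lp (fun _ : G => κ.H) 2) :=
  lp.evalCLM ℂ (fun κ : CovariantRep X S => κ.H →L[ℂ] κ.H) ∞ (κ.inflation j)

theorem inflationComponent_mul (a b : BddOps (fun κ : CovariantRep X S => κ.H)) :
    inflationComponent j κ (a * b) = inflationComponent j κ a * inflationComponent j κ b := rfl

theorem inflationComponent_one :
    inflationComponent j κ (1 : BddOps (fun κ : CovariantRep X S => κ.H)) = 1 := rfl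

theorem norm_inflationComponent_le (b : BddOps (fun κ : CovariantRep X S => κ.H)) :
    ‖inflationComponent j κ b‖ ≤ ‖b‖ :=
  lp.norm_apply_le_norm ENNReal.top_ne_zero b (κ.inflation j)

theorem inflationComponent_generator (f : C(X, ℂ)) (t : S) :
    inflationComponent j κ (univFun X S f * univIsom X S t) =
      weightedPerm (Equiv.mulLeft (j t)) (κ.π f * κ.V t) := rfl

variable [DecidableEq G]

/-- The matrix entries of the inflated component. -/
noncomputable def inflationEntry (g h : G) :
    BddOps (fun κ : CovariantRep X S => κ.H) →L[ℂ] (κ.H →L[ℂ] κ.H) :=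
  (ContinuousLinearMap.compL ℂ κ.H (lp (fun _ : G => κ.H) 2) κ.H
      (lp.evalCLM ℂ (fun _ : G => κ.H) 2 g)) ∘L
    ((ContinuousLinearMap.compL ℂ κ.H (lp (fun _ : G => κ.H) 2) (lp (fun _ : G => κ.H) 2)).flip
      (lp.singleContinuousLinearMap ℂ (fun _ : G => κ.H) 2 h)) ∘L inflationComponent j κ

theorem inflationEntry_apply (g h : G) (b : BddOps (fun κ : CovariantRep X S => κ.H)) (x : κ.H) :
    inflationEntry j κ g h b x = inflationComponent j κ b (lp.single 2 h x) g := rfl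

theorem inflationEntry_generator (g h : G) (f : C(X, ℂ)) (t : S) :
    inflationEntry j κ g h (univFun X S f * univIsom X S t) =
      if j t * g = h then κ.π f * κ.V t else 0 := by
  ext x
  rw [inflationEntry_apply, inflationComponent_generator, weightedPerm_apply, lp.single_apply,
    Equiv.coe_mulLeft]
  beta_reduce
  split_ifs with hg
  · rw [hg, Pi.single_eq_same]
  · rw [Pi.single_eq_of_ne hg, map_zero]; rfl

variable {b c : BddOps (fun κ : CovariantRep X S => κ.H)}

/-- Left translations commute with right translations: the block matrices are of Toeplitz type. -/
theorem inflationEntry_mul_right (hb : b ∈ semicrossedProduct X S) (g h k : G) :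
    inflationEntry j κ (g * k) (h * k) b = inflationEntry j κ g h b := by
  refine semicrossedProduct_ext (fun f t => ?_) hb
  simp only [inflationEntry_generator, ← mul_assoc, mul_left_inj]

theorem inflationEntry_eq_zero (hb : b ∈ semicrossedProduct X S) {g h : G}
    (hgh : ∀ t, j t * g ≠ h) : inflationEntry j κ g h b = 0 := by
  refine semicrossedProduct_ext (L' := 0) (fun f t => ?_) hb
  rw [inflationEntry_generator, if_neg (hgh t)]; rfl

/-- By injectivity of `j`, only monomials with `t = 1` meet the diagonal, and these contribute `π
f`. Commutation passes to limits in one factor at a time. -/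
theorem commute_inflationEntry (hj : Function.Injective j) (hb : b ∈ semicrossedProduct X S)
    (hc : c ∈ semicrossedProduct X S) :
    inflationEntry j κ 1 1 b * inflationEntry j κ 1 1 c =
      inflationEntry j κ 1 1 c * inflationEntry j κ 1 1 b := by
  classical
  have hdiag : ∀ (f : C(X, ℂ)) (t : S),
      inflationEntry j κ 1 1 (univFun X S f * univIsom X S t) =
        if t = 1 then κ.π f else 0 := by
    intro f t
    simp only [inflationEntry_generator, mul_one, map_eq_one_iff j hj]
    split_ifs with ht
    · rw [ht, κ.V_one, mul_one]
    · rfl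
  let mulL : (κ.H →L[ℂ] κ.H) →L[ℂ] (κ.H →L[ℂ] κ.H) →L[ℂ] (κ.H →L[ℂ] κ.H) :=
    ContinuousLinearMap.mul ℂ (κ.H →L[ℂ] κ.H)
  have step : ∀ f : C(X, ℂ), κ.π f * inflationEntry j κ 1 1 c =
      inflationEntry j κ 1 1 c * κ.π f := by
    intro f
    refine semicrossedProduct_ext (L := (mulL (κ.π f)) ∘L inflationEntry j κ 1 1)
      (L' := (mulL.flip (κ.π f)) ∘L inflationEntry j κ 1 1) (fun g t => ?_) hc
    change κ.π f * inflationEntry j κ 1 1 _ = inflationEntry j κ 1 1 _ * κ.π f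
    rw [hdiag]
    split_ifs
    · rw [← map_mul, ← map_mul, mul_comm]
    · rw [mul_zero, zero_mul]
  refine semicrossedProduct_ext
    (L := (mulL.flip (inflationEntry j κ 1 1 c)) ∘L inflationEntry j κ 1 1)
    (L' := (mulL (inflationEntry j κ 1 1 c)) ∘L inflationEntry j κ 1 1) (fun f t => ?_) hb
  change inflationEntry j κ 1 1 _ * inflationEntry j κ 1 1 c =
    inflationEntry j κ 1 1 c * inflationEntry j κ 1 1 _
  rw [hdiag]
  split_ifs
  · exact step f
  · rw [mul_zero, zero_mul]

/-- If `S` has no invertible elements but `1`, then an element of the diagonal of the semicrossed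
product is block diagonal in inflated representations, with constant diagonal. -/
theorem inflationComponent_single (hj : Function.Injective j) (hS : ∀ s : S, IsUnit s → s = 1)
    (hb : b ∈ semicrossedProduct X S) (hc : c ∈ semicrossedProduct X S)
    (hbc : star (inflationComponent j κ b) = inflationComponent j κ c) (h : G) (x : κ.H) :
    inflationComponent j κ b (lp.single 2 h x) =
      lp.single 2 h (inflationEntry j κ 1 1 b x) := by
  refine lp.ext (funext fun g => ?_)
  rw [lp.single_apply]
  by_cases hg : g = h
  · subst hg
    rw [Pi.single_eq_same, ← inflationEntry_apply]
    conv_lhs => rw [← one_mul g]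
    rw [inflationEntry_mul_right j κ hb]
  · rw [Pi.single_eq_of_ne hg, ← inflationEntry_apply]
    by_cases hs : ∃ s, j s * g = h
    · obtain ⟨s, rfl⟩ := hs
      -- This entry of `c` is the adjoint of the entry of `b` at `(g, j s * g)`. If it were nonzero,
      -- some `t` would satisfy `t * s = 1`, making `s` invertible, hence `1`, against `g ≠ h`.
      have hz : inflationEntry j κ (j s * g) g c = 0 := by
        refine inflationEntry_eq_zero j κ hc fun t ht => hg ?_
        have hts : t * s = 1 := hj (by
          rw [map_mul, map_one]
          exact mul_right_cancel (b := g) (by rw [mul_assoc, ht, one_mul]))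
        have hst : s * t = 1 := hj (by
          rw [map_mul, map_one]
          exact mul_eq_one_comm.1 (by rw [← map_mul, hts, map_one]))
        rw [hS s ⟨⟨s, t, hst, hts⟩, rfl⟩, map_one, one_mul]
      refine ext_inner_left ℂ fun y => ?_
      rw [inflationEntry_apply, inner_zero_right,
        ← lp.inner_single_left (𝕜 := ℂ) (G := fun _ : G => κ.H) g y,
        ← ContinuousLinearMap.adjoint_inner_left, ← ContinuousLinearMap.star_eq_adjoint, hbc,
        lp.inner_single_right, ← inflationEntry_apply, hz]
      exact inner_zero_left _
    · push Not at hs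
      rw [inflationEntry_eq_zero j κ hb hs]; rfl

theorem inflationComponent_commutator_single (hj : Function.Injective j)
    (hS : ∀ s : S, IsUnit s → s = 1) {b' c' : BddOps (fun κ : CovariantRep X S => κ.H)}
    (hb : b ∈ semicrossedProduct X S) (hb' : b' ∈ semicrossedProduct X S)
    (hbb' : star (inflationComponent j κ b) = inflationComponent j κ b')
    (hc : c ∈ semicrossedProduct X S) (hc' : c' ∈ semicrossedProduct X S)
    (hcc' : star (inflationComponent j κ c) = inflationComponent j κ c') (h : G) (x : κ.H) :
    inflationComponent j κ (b * c - c * b) (lp.single 2 h x) = 0 := by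
  rw [map_sub, inflationComponent_mul, inflationComponent_mul, sub_apply,
    mul_apply_eq_comp, mul_apply_eq_comp,
    inflationComponent_single j κ hj hS hb hb' hbb', inflationComponent_single j κ hj hS hc hc' hcc',
    inflationComponent_single j κ hj hS hb hb' hbb', inflationComponent_single j κ hj hS hc hc' hcc',
    sub_eq_zero]
  congr 1
  exact DFunLike.congr_fun (commute_inflationEntry j κ hj hb hc) x

end Inflation

/-! ### Følner sets along a filter -/

section Folner

variable {G : Type u} [Group G] [DecidableEq G]

theorem card_filter_mul_mem_add (K : Finset G) (g : G) :
    (K.filter fun x => g * x ∈ K).card + ((K.image fun x => g * x) \ K).card = K.card := by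
  have h : (K.image fun x => g * x) \ K = (K.filter fun x => g * x ∉ K).image fun x => g * x := by
    ext y
    simp only [Finset.mem_sdiff, Finset.mem_image, Finset.mem_filter]
    constructor
    · rintro ⟨⟨x, hx, rfl⟩, hy⟩
      exact ⟨x, ⟨hx, hy⟩, rfl⟩
    · rintro ⟨x, ⟨hx, hy⟩, rfl⟩
      exact ⟨⟨x, hx, rfl⟩, hy⟩
  rw [h, Finset.card_image_of_injective _ (mul_right_injective g)]
  exact Finset.card_filter_add_card_filter_not _

/-- Følner sets are chosen for pairs `(F, n)` with `ε = 1 / (n + 1)`; as the pairs grow, each `g`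
eventually lies in `F`. -/
theorem IsAmenableGroup.exists_filter (hG : IsAmenableGroup G) :
    ∃ L : Filter (Finset G), L.NeBot ∧
      ∀ g : G, Filter.Tendsto
        (fun K => ((K.card : ℂ))⁻¹ * ((K.filter fun x => g * x ∈ K).card : ℂ)) L (𝓝 1) := by
  have h := fun p : Finset G × ℕ => hG p.1 (1 / ((p.2 : ℝ) + 1)) Nat.one_div_pos_of_nat
  choose K hK hKF using h
  refine ⟨Filter.map K Filter.atTop, inferInstance, fun g => Filter.tendsto_map'_iff.2 ?_⟩
  have hlim : Filter.Tendsto (fun p : Finset G × ℕ => 1 / ((p.2 : ℝ) + 1)) Filter.atTop (𝓝 0) := by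
    rw [← Filter.prod_atTop_atTop_eq]
    exact tendsto_one_div_add_atTop_nhds_zero_nat.comp Filter.tendsto_snd
  rw [tendsto_iff_norm_sub_tendsto_zero]
  refine squeeze_zero' (Filter.Eventually.of_forall fun _ => norm_nonneg _) ?_ hlim
  filter_upwards [Filter.eventually_ge_atTop (({g}, 0) : Finset G × ℕ)] with p hp
  have hg : g ∈ p.1 := hp.1 (Finset.mem_singleton_self g)
  have h1 : (((((K p).image fun x => g * x) \ K p).card : ℝ)) ≤
      1 / ((p.2 : ℝ) + 1) * (K p).card := by
    convert hKF p g hg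
  have h2 := card_filter_mul_mem_add (K p) g
  have h3 : (0 : ℝ) < (K p).card := by exact_mod_cast (hK p).card_pos
  have h4 : ((K p).card : ℂ) ≠ 0 := by exact_mod_cast h3.ne'
  have h5 : ((K p).card : ℂ)⁻¹ * (((K p).filter fun x => g * x ∈ K p).card : ℂ) - 1 =
      -(((K p).card : ℂ)⁻¹ * ((((K p).image fun x => g * x) \ K p).card : ℂ)) := by
    have h6 : ((((K p).filter fun x => g * x ∈ K p).card : ℂ)) =
        (K p).card - ((((K p).image fun x => g * x) \ K p).card : ℂ) := by
      rw [← h2]; push_cast; ring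
    rw [h6, mul_sub, inv_mul_cancel₀ h4]
    ring
  simp only [Function.comp_apply]
  rw [h5, norm_neg, norm_mul, norm_inv, Complex.norm_natCast, Complex.norm_natCast,
    inv_mul_le_iff₀ h3, mul_comm]
  exact h1

end Folner

/-! ### Recovering a representation from its inflation -/

section Averaging

variable {X S : Type u} [TopologicalSpace X] [CompactSpace X] [Monoid S]
  [MulAction S X] [ContinuousConstSMul S X]

theorem tendsto_zero_of_mem_semicrossedProduct {α : Type*} {L : Filter α}
    {ψ : α → BddOps (fun κ : CovariantRep X S => κ.H) →L[ℂ] ℂ} {C : ℝ}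
    (hC : ∀ k b, ‖ψ k b‖ ≤ C * ‖b‖)
    (h : ∀ f t, Filter.Tendsto (fun k => ψ k (univFun X S f * univIsom X S t)) L (𝓝 0))
    {b : BddOps (fun κ : CovariantRep X S => κ.H)} (hb : b ∈ semicrossedProduct X S) :
    Filter.Tendsto (fun k => ψ k b) L (𝓝 0) := by
  refine semicrossedProduct_le (P :=
    { carrier := {b | Filter.Tendsto (fun k => ψ k b) L (𝓝 0)}
      add_mem' := fun {a b} ha hb => by
        simpa only [Set.mem_ofPred_eq, map_add, add_zero] using Filter.Tendsto.add ha hb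
      zero_mem' := by
        simpa only [Set.mem_ofPred_eq, map_zero] using tendsto_const_nhds
      smul_mem' := fun c a ha => by
        simpa only [Set.mem_ofPred_eq, map_smul, smul_zero] using Filter.Tendsto.const_smul ha c })
    ?_ h hb
  refine isClosed_of_closure_subset fun a ha => ?_
  -- Working with `|C| + 1` avoids a division by zero and any sign condition on `C`.
  have hC' : 0 < |C| + 1 := by positivity
  refine Metric.tendsto_nhds.2 fun ε hε => ?_
  obtain ⟨a', ha', hd⟩ := Metric.mem_closure_iff.1 ha (ε / 2 / (|C| + 1)) (by positivity)
  filter_upwards [Metric.tendsto_nhds.1 ha' (ε / 2) (by positivity)] with k hk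
  rw [dist_zero_right] at hk ⊢
  rw [dist_eq_norm, lt_div_iff₀ hC'] at hd
  have h1 : ψ k a = ψ k (a - a') + ψ k a' := by rw [map_sub, sub_add_cancel]
  have h2 : ‖ψ k (a - a')‖ ≤ ‖a - a'‖ * (|C| + 1) := by
    refine (hC k _).trans ?_
    rw [mul_comm]
    exact mul_le_mul_of_nonneg_left ((le_abs_self C).trans (by linarith)) (norm_nonneg _)
  rw [h1]
  exact (norm_add_le _ _).trans_lt (by linarith)

variable {G : Type u} [Group G] [DecidableEq G] (j : S →* G) (κ : CovariantRep X S)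

/-- The vector of `ℓ²(G; H)` that is constant on a finite set. -/
noncomputable def constOn {H : Type u} [NormedAddCommGroup H] [InnerProductSpace ℂ H]
    (K : Finset G) (x : H) : lp (fun _ : G => H) 2 :=
  ∑ g ∈ K, lp.single 2 g x

theorem constOn_apply {H : Type u} [NormedAddCommGroup H] [InnerProductSpace ℂ H]
    (K : Finset G) (x : H) (g : G) : constOn K x g = if g ∈ K then x else 0 := by
  rw [constOn, lp.coeFn_sum, Finset.sum_apply]
  simp [Pi.single_apply]

theorem norm_constOn {H : Type u} [NormedAddCommGroup H] [InnerProductSpace ℂ H]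
    (K : Finset G) (x : H) : ‖constOn K x‖ = √K.card * ‖x‖ := by
  have h := lp.norm_sum_single (E := fun _ : G => H) (p := 2) (by norm_num) (fun _ => x) K
  simp only [ENNReal.toReal_ofNat, Real.rpow_ofNat, Finset.sum_const, nsmul_eq_mul] at h
  rw [constOn, ← Real.sqrt_sq (norm_nonneg (∑ g ∈ K, lp.single 2 g x)), h,
    Real.sqrt_mul (Nat.cast_nonneg _), Real.sqrt_sq (norm_nonneg _)]

theorem inner_constOn {H : Type u} [NormedAddCommGroup H] [InnerProductSpace ℂ H]
    (K : Finset G) (y : H) (ξ : lp (fun _ : G => H) 2) :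
    inner ℂ (constOn K y) ξ = ∑ g ∈ K, inner ℂ y (ξ g) := by
  rw [constOn, sum_inner]
  exact Finset.sum_congr rfl fun g _ => lp.inner_single_left (𝕜 := ℂ) (G := fun _ : G => H) g y ξ

/-- The difference between the averaged matrix coefficient of an inflated component and the matrix
coefficient of the original component. -/
noncomputable def averageDefect (x y : κ.H) (K : Finset G) :
    BddOps (fun κ : CovariantRep X S => κ.H) →L[ℂ] ℂ :=
  (K.card : ℂ)⁻¹ • ((innerSL ℂ (constOn K y)) ∘L
    (ContinuousLinearMap.apply ℂ (lp (fun _ : G => κ.H) 2) (constOn K x)) ∘L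
      inflationComponent j κ) -
  (innerSL ℂ y) ∘L (ContinuousLinearMap.apply ℂ κ.H x) ∘L
    lp.evalCLM ℂ (fun κ : CovariantRep X S => κ.H →L[ℂ] κ.H) ∞ κ

theorem averageDefect_apply (x y : κ.H) (K : Finset G)
    (b : BddOps (fun κ : CovariantRep X S => κ.H)) :
    averageDefect j κ x y K b =
      (K.card : ℂ)⁻¹ * inner ℂ (constOn K y) (inflationComponent j κ b (constOn K x)) -
        inner ℂ y ((b : ∀ κ : CovariantRep X S, κ.H →L[ℂ] κ.H) κ x) := rfl

/-- The two factors `√K.card` from the constant vectors cancel the average, so the bound is uniform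
in `K`. -/
theorem norm_averageDefect_le (x y : κ.H) (K : Finset G)
    (b : BddOps (fun κ : CovariantRep X S => κ.H)) :
    ‖averageDefect j κ x y K b‖ ≤ 2 * (‖x‖ * ‖y‖) * ‖b‖ := by
  rw [averageDefect_apply]
  have h1 : ‖inner ℂ y ((b : ∀ κ : CovariantRep X S, κ.H →L[ℂ] κ.H) κ x)‖ ≤
      ‖y‖ * (‖b‖ * ‖x‖) := by
    refine (norm_inner_le_norm _ _).trans (mul_le_mul_of_nonneg_left ?_ (norm_nonneg _))
    exact ContinuousLinearMap.le_of_opNorm_le _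
      (lp.norm_apply_le_norm ENNReal.top_ne_zero b κ) x
  have h2 : ‖inner ℂ (constOn K y) (inflationComponent j κ b (constOn K x))‖ ≤
      K.card * (‖y‖ * (‖b‖ * ‖x‖)) := by
    refine (norm_inner_le_norm _ _).trans ?_
    calc _ ≤ ‖constOn K y‖ * (‖b‖ * ‖constOn K x‖) :=
          mul_le_mul_of_nonneg_left (ContinuousLinearMap.le_of_opNorm_le _
            (norm_inflationComponent_le j κ b) _) (norm_nonneg _)
      _ = (√K.card * √K.card) * (‖y‖ * (‖b‖ * ‖x‖)) := by
          rw [norm_constOn, norm_constOn]; ring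
      _ = _ := by rw [Real.mul_self_sqrt (Nat.cast_nonneg _)]
  have h3 : ‖(K.card : ℂ)⁻¹ * inner ℂ (constOn K y) (inflationComponent j κ b (constOn K x))‖ ≤
      ‖y‖ * (‖b‖ * ‖x‖) := by
    rw [norm_mul, norm_inv, Complex.norm_natCast]
    rcases Nat.eq_zero_or_pos K.card with h0 | h0
    · rw [h0, Nat.cast_zero, inv_zero, zero_mul]; positivity
    · exact (inv_mul_le_iff₀ (by exact_mod_cast h0)).2 h2
  refine (norm_sub_le _ _).trans ((add_le_add h3 h1).trans_eq ?_)
  ring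

/-- The average counts the proportion of `K` that translation by `j t` keeps in `K`; along Følner
sets it tends to `1`. -/
theorem averageDefect_generator (x y : κ.H) (K : Finset G) (f : C(X, ℂ)) (t : S) :
    averageDefect j κ x y K (univFun X S f * univIsom X S t) =
      ((K.card : ℂ)⁻¹ * ((K.filter fun g => j t * g ∈ K).card : ℂ) - 1) *
        inner ℂ y ((κ.π f * κ.V t) x) := by
  rw [averageDefect_apply, inflationComponent_generator, inner_constOn]
  have h : ∀ g ∈ K, inner ℂ y (weightedPerm (Equiv.mulLeft (j t)) (κ.π f * κ.V t)
      (constOn K x) g) = if j t * g ∈ K then inner ℂ y ((κ.π f * κ.V t) x) else 0 := by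
    intro g _
    rw [weightedPerm_apply, constOn_apply, Equiv.coe_mulLeft]
    beta_reduce
    split_ifs
    · rfl
    · rw [map_zero, inner_zero_right]
  rw [Finset.sum_congr rfl h, ← Finset.sum_filter, Finset.sum_const, nsmul_eq_mul, sub_mul,
    one_mul, mul_assoc]
  rfl

/-- Matrix coefficients at `κ` are limits of averaged coefficients of the inflation: for monomials
by the Følner property, then on the closed span by uniform boundedness. -/
theorem apply_eq_zero_of_inflationComponent_single (hG : IsAmenableGroup G)
    {b : BddOps (fun κ : CovariantRep X S => κ.H)} (hb : b ∈ semicrossedProduct X S)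
    (h : ∀ (g : G) (x : κ.H), inflationComponent j κ b (lp.single 2 g x) = 0) :
    (b : ∀ κ : CovariantRep X S, κ.H →L[ℂ] κ.H) κ = 0 := by
  obtain ⟨L, hL, hlim⟩ := hG.exists_filter
  ext x
  refine ext_inner_left ℂ fun y => ?_
  have h1 : Filter.Tendsto (fun K => averageDefect j κ x y K b) L (𝓝 0) := by
    refine tendsto_zero_of_mem_semicrossedProduct (norm_averageDefect_le j κ x y)
      (fun f t => ?_) hb
    simp only [averageDefect_generator]
    have := ((hlim (j t)).sub_const 1).mul_const (inner ℂ y ((κ.π f * κ.V t) x))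
    simpa only [sub_self, zero_mul] using this
  have h2 : ∀ K : Finset G, averageDefect j κ x y K b =
      -inner ℂ y ((b : ∀ κ : CovariantRep X S, κ.H →L[ℂ] κ.H) κ x) := by
    intro K
    have h0 : inflationComponent j κ b (constOn K x) = 0 := by
      rw [constOn, map_sum]
      exact Finset.sum_eq_zero fun g _ => h g x
    rw [averageDefect_apply, h0, inner_zero_right, mul_zero, zero_sub]
  simp only [h2] at h1
  have h3 := tendsto_nhds_unique h1 tendsto_const_nhds
  rw [zero_apply, inner_zero_right, ← neg_eq_zero, ← h3]

end Averaging

/-- `‖x‖ = ‖T' (T x)‖ ≤ ‖T x‖ ≤ ‖x‖`, so `T` is a surjective isometry. -/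
theorem star_eq_of_norm_le_one {H : Type u} [NormedAddCommGroup H] [InnerProductSpace ℂ H]
    [CompleteSpace H] {T T' : H →L[ℂ] H} (h : T * T' = 1) (h' : T' * T = 1) (hT : ‖T‖ ≤ 1)
    (hT' : ‖T'‖ ≤ 1) : star T = T' := by
  have hiso : ∀ x, ‖T x‖ = ‖x‖ := by
    intro x
    refine le_antisymm (by simpa using T.le_of_opNorm_le hT x) ?_
    have h1 : T' (T x) = x := DFunLike.congr_fun h' x
    have h2 := T'.le_of_opNorm_le hT' (T x)
    rwa [h1, one_mul] at h2
  have h1 : star T * T = 1 := T.norm_map_iff_adjoint_comp_self.1 hiso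
  calc star T = star T * (T * T') := by rw [h, mul_one]
    _ = T' := by rw [← mul_assoc, h1, one_mul]

/-! ### Commutation of invertible contractions -/

section Diagonal

variable {X S : Type u} [TopologicalSpace X] [CompactSpace X] [Monoid S]
  [MulAction S X] [ContinuousConstSMul S X]

/-- Invertible contractions with contractive inverse in the semicrossed product commute, if the
acting monoid embeds in an amenable group and has no invertible elements but `1`. -/
theorem commute_of_invertible_contractions (hemb : EmbedsInAmenableGroup S)
    (hS : ∀ s : S, IsUnit s → s = 1) {b b' c c' : BddOps (fun κ : CovariantRep X S => κ.H)}
    (hb : b ∈ semicrossedProduct X S) (hb' : b' ∈ semicrossedProduct X S)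
    (hc : c ∈ semicrossedProduct X S) (hc' : c' ∈ semicrossedProduct X S)
    (hbb' : b * b' = 1) (hb'b : b' * b = 1) (hcc' : c * c' = 1) (hc'c : c' * c = 1)
    (nb : ∀ κ, ‖(b : ∀ κ : CovariantRep X S, κ.H →L[ℂ] κ.H) κ‖ ≤ 1)
    (nb' : ∀ κ, ‖(b' : ∀ κ : CovariantRep X S, κ.H →L[ℂ] κ.H) κ‖ ≤ 1)
    (nc : ∀ κ, ‖(c : ∀ κ : CovariantRep X S, κ.H →L[ℂ] κ.H) κ‖ ≤ 1)
    (nc' : ∀ κ, ‖(c' : ∀ κ : CovariantRep X S, κ.H →L[ℂ] κ.H) κ‖ ≤ 1) :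
    b * c = c * b := by
  classical
  obtain ⟨G, _, j, hG, hj⟩ := hemb
  rw [← sub_eq_zero]
  refine lp.ext (funext fun κ => ?_)
  have hs : ∀ {d d' : BddOps (fun κ : CovariantRep X S => κ.H)}, d * d' = 1 → d' * d = 1 →
      (∀ κ, ‖(d : ∀ κ : CovariantRep X S, κ.H →L[ℂ] κ.H) κ‖ ≤ 1) →
      (∀ κ, ‖(d' : ∀ κ : CovariantRep X S, κ.H →L[ℂ] κ.H) κ‖ ≤ 1) →
      star (inflationComponent j κ d) = inflationComponent j κ d' := by
    intro d d' h1 h2 h3 h4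
    refine star_eq_of_norm_le_one ?_ ?_ (h3 (κ.inflation j)) (h4 (κ.inflation j))
    · rw [← inflationComponent_mul, h1, inflationComponent_one]
    · rw [← inflationComponent_mul, h2, inflationComponent_one]
  exact apply_eq_zero_of_inflationComponent_single j κ hG
    (Subalgebra.sub_mem _ (Subalgebra.mul_mem _ hb hc) (Subalgebra.mul_mem _ hc hb))
    (inflationComponent_commutator_single j κ hj hS hb hb' (hs hbb' hb'b nb nb') hc hc'
      (hs hcc' hc'c nc nc'))

end Diagonal

/-! ### Relations between the generators of `A(R)` -/

section UniversalGenerators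

variable {R : Type u} [CommRing R]

theorem univS_one : univS R 1 = 1 := by
  refine lp.ext (funext fun ρ => ?_)
  ext x
  have h := ρ.S_mul 1 1
  rw [mul_one] at h
  exact (ρ.S_isometry 1).injective (DFunLike.congr_fun h x)

theorem univU_zero : univU R 0 = 1 := by
  refine lp.ext (funext fun ρ => ?_)
  have h := ρ.U_add 0 0
  rw [add_zero] at h
  have h1 := (ρ.U_mem_unitary 0).1
  change ρ.U 0 = 1
  calc ρ.U 0 = (star (ρ.U 0) * ρ.U 0) * ρ.U 0 := by rw [h1, one_mul]
    _ = 1 := by rw [mul_assoc, h, h1]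

theorem univS_mul (r t : R⁰) : univS R r * univS R t = univS R (r * t) :=
  lp.ext <| funext fun ρ => ρ.S_mul r t

theorem univU_add (n m : R) : univU R n * univU R m = univU R (n + m) :=
  lp.ext <| funext fun ρ => ρ.U_add n m

theorem univS_mem (r : R⁰) : univS R r ∈ domainAlgebra R :=
  Subalgebra.le_topologicalClosure _ (Algebra.subset_adjoin (Or.inr ⟨r, rfl⟩))

theorem univU_mem (n : R) : univU R n ∈ domainAlgebra R :=
  Subalgebra.le_topologicalClosure _ (Algebra.subset_adjoin (Or.inl ⟨n, rfl⟩))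

theorem norm_univS_le (r : R⁰) : ‖univS R r‖ ≤ 1 :=
  lp.norm_le_of_forall_le zero_le_one fun ρ => norm_le_one_of_isometry (ρ.S_isometry r)

theorem norm_univU_le (n : R) : ‖univU R n‖ ≤ 1 :=
  lp.norm_le_of_forall_le zero_le_one fun ρ =>
    (CStarRing.norm_of_mem_unitary (ρ.U_mem_unitary n)).le

end UniversalGenerators

/-! ### The regular representation and triviality of units -/

section Regular

variable (R : Type u) [CommRing R] [IsDomain R]

/-- The representation of `R` on `ℓ²(Q)`, `Q` the field of fractions, by translations and
dilations. -/
noncomputable def IsometricRep.regular : IsometricRep R where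
  H := lp (fun _ : FractionRing R => ℂ) 2
  U := fun n => weightedPerm (Equiv.subRight (algebraMap R (FractionRing R) n)) 1
  S := fun r => weightedPerm (Equiv.mulLeft₀ (algebraMap R (FractionRing R) r)⁻¹
    (inv_ne_zero (IsFractionRing.to_map_ne_zero_of_mem_nonZeroDivisors r.2))) 1
  U_mem_unitary := fun n => weightedPerm_mem_unitary _
  S_isometry := fun r => weightedPerm_isometry _ isometry_id
  S_mul := fun r t => by
    rw [weightedPerm_mul, one_mul]
    congr 1
    ext x
    simp only [Equiv.Perm.mul_apply, Equiv.mulLeft₀_apply, Submonoid.coe_mul, map_mul, mul_inv]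
    ring
  U_add := fun n m => by
    rw [weightedPerm_mul, one_mul]
    congr 1
    ext x
    simp [sub_sub]
  S_mul_U := fun r n => by
    rw [weightedPerm_mul, weightedPerm_mul]
    congr 1
    ext x
    have hr : algebraMap R (FractionRing R) r ≠ 0 :=
      IsFractionRing.to_map_ne_zero_of_mem_nonZeroDivisors r.2
    simp [mul_sub, hr]

variable {R}

theorem eq_one_of_univS_commute_univU {r : R⁰}
    (h : univS R r * univU R 1 = univU R 1 * univS R r) : (r : R) = 1 := by
  classical
  have h1 : (IsometricRep.regular R).S r * (IsometricRep.regular R).U 1 =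
      (IsometricRep.regular R).U 1 * (IsometricRep.regular R).S r :=
    congrFun (congrArg (fun a : BddOps (fun ρ : IsometricRep R => ρ.H) =>
      (a : ∀ ρ : IsometricRep R, ρ.H →L[ℂ] ρ.H)) h) (IsometricRep.regular R)
  -- On the point mass at `-1`, one product gives the point mass at `0`, the other the one at `1 -
  -- r`; they are compared at `0`.
  have h2 := congrArg (fun T : lp (fun _ : FractionRing R => ℂ) 2 →L[ℂ]
    lp (fun _ : FractionRing R => ℂ) 2 => T (lp.single 2 (-1) 1) 0) h1
  change (Pi.single (-1 : FractionRing R) (1 : ℂ) : FractionRing R → ℂ)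
      ((algebraMap R (FractionRing R) r)⁻¹ * 0 - algebraMap R (FractionRing R) 1) =
    (Pi.single (-1 : FractionRing R) (1 : ℂ) : FractionRing R → ℂ)
      ((algebraMap R (FractionRing R) r)⁻¹ * (0 - algebraMap R (FractionRing R) 1)) at h2
  simpa [Pi.single_apply] using h2

theorem map_mul_map_eq_one {A B : Type*} [Semiring A] [Semiring B] [Algebra ℂ A] [Algebra ℂ B]
    (Φ : A ≃ₐ[ℂ] B) {a b : A} (h : a * b = 1) : Φ a * Φ b = 1 := by
  rw [← map_mul, h, map_one]

theorem mul_comm_of_map_mul_comm {A B : Type*} [Semiring A] [Semiring B] [Algebra ℂ A]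
    [Algebra ℂ B] (Φ : A ≃ₐ[ℂ] B) {a b : A} (h : Φ a * Φ b = Φ b * Φ a) : a * b = b * a :=
  Φ.injective (by rw [map_mul, map_mul, h])

/-- A completely isometric isomorphism with a semicrossed product forces trivial units. -/
theorem eq_one_of_isUnit {X S : Type u} [TopologicalSpace X] [CompactSpace X] [Monoid S]
    [MulAction S X] [ContinuousConstSMul S X] (hemb : EmbedsInAmenableGroup S)
    (hS : ∀ s : S, IsUnit s → s = 1)
    (hΦ : CompletelyIsometricallyIsomorphic (domainAlgebra R) (semicrossedProduct X S))
    {x : R} (hx : IsUnit x) : x = 1 := by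
  obtain ⟨Φ, hΦ⟩ := hΦ
  obtain ⟨y, hxy⟩ := hx.exists_right_inv
  have hx0 : x ∈ R⁰ := hx.mem_nonZeroDivisors
  have hy0 : y ∈ R⁰ := (IsUnit.of_mul_eq_one x (by rw [mul_comm, hxy])).mem_nonZeroDivisors
  -- Of complete isometry, only the case of `1 × 1` matrices is used.
  have hnorm : ∀ (a : domainAlgebra R), ‖(a : BddOps (fun ρ : IsometricRep R => ρ.H))‖ ≤ 1 →
      ∀ κ, ‖((Φ a : BddOps (fun κ : CovariantRep X S => κ.H)) :
        ∀ κ : CovariantRep X S, κ.H →L[ℂ] κ.H) κ‖ ≤ 1 := by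
    intro a ha κ
    refine (norm_apply_le_matrixNorm _ κ).trans ?_
    rw [hΦ 1 (fun _ _ => a)]
    exact (matrixNorm_le_norm _).trans ha
  have hmul : ∀ a b : domainAlgebra R, (a : BddOps (fun ρ : IsometricRep R => ρ.H)) * b = 1 →
      (Φ a : BddOps (fun κ : CovariantRep X S => κ.H)) * Φ b = 1 := by
    intro a b hab
    have h1 : a * b = 1 := Subtype.ext hab
    exact congrArg Subtype.val (map_mul_map_eq_one Φ h1)
  let s : domainAlgebra R := ⟨univS R ⟨x, hx0⟩, univS_mem _⟩
  let s' : domainAlgebra R := ⟨univS R ⟨y, hy0⟩, univS_mem _⟩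
  let v : domainAlgebra R := ⟨univU R 1, univU_mem _⟩
  let v' : domainAlgebra R := ⟨univU R (-1), univU_mem _⟩
  have hss' : univS R ⟨x, hx0⟩ * univS R ⟨y, hy0⟩ = 1 := by
    rw [univS_mul, ← univS_one]
    exact congrArg _ (Subtype.ext hxy)
  have hs's : univS R ⟨y, hy0⟩ * univS R ⟨x, hx0⟩ = 1 := by
    rw [univS_mul, ← univS_one]
    exact congrArg _ (Subtype.ext ((mul_comm y x).trans hxy))
  have hvv' : univU R 1 * univU R (-1) = 1 := by
    rw [univU_add, ← univU_zero, add_neg_cancel]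
  have hv'v : univU R (-1) * univU R 1 = 1 := by
    rw [univU_add, ← univU_zero, neg_add_cancel]
  have hcomm := commute_of_invertible_contractions hemb hS (Φ s).2 (Φ s').2 (Φ v).2 (Φ v').2
    (hmul s s' hss') (hmul s' s hs's) (hmul v v' hvv') (hmul v' v hv'v)
    (hnorm s (norm_univS_le _)) (hnorm s' (norm_univS_le _))
    (hnorm v (norm_univU_le _)) (hnorm v' (norm_univU_le _))
  have h1 : Φ s * Φ v = Φ v * Φ s := Subtype.ext hcomm
  exact eq_one_of_univS_commute_univU (r := ⟨x, hx0⟩)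
    (congrArg Subtype.val (mul_comm_of_map_mul_comm Φ h1))

end Regular

/-! ### The dual group and its continuous functions -/

section Dual

variable (R : Type u) [CommRing R]

/-- The Pontryagin dual of the discrete additive group of `R`, with the topology of pointwise
convergence. -/
def additiveDual : Set (R → Circle) := {χ | ∀ a b, χ (a + b) = χ a * χ b}

theorem isClosed_additiveDual : IsClosed (additiveDual R) := by
  simp only [additiveDual, Set.ofPred_forall]
  exact isClosed_iInter fun a => isClosed_iInter fun b =>
    isClosed_eq (continuous_apply (a + b))
      (Continuous.mul (f := fun χ : R → Circle => χ a) (g := fun χ : R → Circle => χ b)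
        (continuous_apply a) (continuous_apply b))

instance : CompactSpace (additiveDual R) :=
  isCompact_iff_compactSpace.1 (isClosed_additiveDual R).isCompact

instance : MulAction R⁰ (additiveDual R) where
  smul r χ := ⟨fun n => χ.1 (r * n), fun a b => by
    beta_reduce
    rw [mul_add, χ.2]⟩
  one_smul χ := Subtype.ext <| funext fun n => congrArg χ.1 (one_mul n)
  mul_smul r s χ := Subtype.ext <| funext fun n => congrArg χ.1 <| by
    rw [Submonoid.coe_mul, mul_comm (r : R), mul_assoc]

instance : ContinuousConstSMul R⁰ (additiveDual R) where
  continuous_const_smul r := Continuous.subtype_mk (f := fun χ : additiveDual R => fun n => χ.1 ((r : R) * n))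
    (continuous_pi fun n => (continuous_apply ((r : R) * n)).comp continuous_subtype_val) _

variable {R}

/-- Evaluation at `n ∈ R`, as a continuous function on the dual. -/
def evalDual (n : R) : C(additiveDual R, ℂ) :=
  ⟨fun χ => (χ.1 n : ℂ),
    continuous_subtype_val.comp ((continuous_apply n).comp continuous_subtype_val)⟩

theorem evalDual_apply (n : R) (χ : additiveDual R) : evalDual n χ = (χ.1 n : ℂ) := rfl

theorem evalDual_mul (n m : R) : evalDual n * evalDual m = evalDual (n + m) := by
  ext χ
  rw [ContinuousMap.mul_apply, evalDual_apply, evalDual_apply, evalDual_apply, χ.2, Circle.coe_mul]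

theorem additiveDual_apply_zero (χ : additiveDual R) : χ.1 0 = 1 := by
  have h := χ.2 0 0
  rw [add_zero] at h
  exact left_eq_mul.1 h

theorem evalDual_zero : evalDual (0 : R) = 1 := by
  ext χ
  rw [evalDual_apply, additiveDual_apply_zero, Circle.coe_one, ContinuousMap.one_apply]

theorem star_evalDual (n : R) : star (evalDual n) = evalDual (-n) := by
  ext χ
  have h : χ.1 n * χ.1 (-n) = 1 := by
    rw [← χ.2, add_neg_cancel, additiveDual_apply_zero]
  rw [ContinuousMap.star_apply, evalDual_apply, evalDual_apply, eq_inv_of_mul_eq_one_right h,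
    Circle.coe_inv_eq_conj]
  rfl

theorem evalDual_mem_unitary (n : R) : evalDual n ∈ unitary C(additiveDual R, ℂ) := by
  rw [Unitary.mem_iff, star_evalDual, evalDual_mul, evalDual_mul, neg_add_cancel, add_neg_cancel,
    evalDual_zero]
  exact ⟨rfl, rfl⟩

/-- Closed subalgebras that contain all evaluations contain all continuous functions. -/
theorem mem_of_evalDual_mem {P : Subalgebra ℂ C(additiveDual R, ℂ)}
    (hP : IsClosed (P : Set C(additiveDual R, ℂ))) (h : ∀ n, evalDual n ∈ P)
    (f : C(additiveDual R, ℂ)) : f ∈ P := by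
  let A : StarSubalgebra ℂ C(additiveDual R, ℂ) :=
    { Algebra.adjoin ℂ (Set.range (evalDual (R := R))) with
      star_mem' := fun {a} ha => by
        induction ha using Algebra.adjoin_induction with
        | mem x hx =>
          obtain ⟨n, rfl⟩ := hx
          exact Algebra.subset_adjoin ⟨-n, (star_evalDual n).symm⟩
        | algebraMap c =>
          rw [← algebraMap_star_comm]
          exact Subalgebra.algebraMap_mem _ _
        | add x y _ _ hx hy => rw [star_add]; exact Subalgebra.add_mem _ hx hy
        | mul x y _ _ hx hy => rw [star_mul]; exact Subalgebra.mul_mem _ hy hx }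
  -- Stone–Weierstrass: conjugation sends evaluation at `n` to evaluation at `-n`, and evaluations
  -- separate characters.
  have hA : A.topologicalClosure = ⊤ := by
    refine ContinuousMap.starSubalgebra_topologicalClosure_eq_top_of_separatesPoints A ?_
    intro χ χ' hne
    obtain ⟨n, hn⟩ := Function.ne_iff.1 (Subtype.coe_injective.ne hne)
    exact ⟨evalDual n, ⟨evalDual n, Algebra.subset_adjoin ⟨n, rfl⟩, rfl⟩,
      fun h => hn (Circle.ext h)⟩
  have hf : f ∈ closure (A : Set C(additiveDual R, ℂ)) := by
    rw [← StarSubalgebra.topologicalClosure_coe, hA]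
    trivial
  refine closure_minimal ?_ hP hf
  intro a ha
  exact (Algebra.adjoin_le (by rintro _ ⟨n, rfl⟩; exact h n) :
    Algebra.adjoin ℂ (Set.range (evalDual (R := R))) ≤ P) ha

/-- Each `φ` in the Gelfand spectrum of `A` gives the character `n ↦ φ (U n)`. Pulling functions
back along this map `τ` and inverting the Gelfand transform yields `π`. -/
theorem exists_starAlgHom_of_comm {A : Type*} [CommCStarAlgebra A] {U : R → A}
    (hU : ∀ n, U n ∈ unitary A) (hadd : ∀ n m, U n * U m = U (n + m)) :
    ∃ π : C(additiveDual R, ℂ) →⋆ₐ[ℂ] A, ∀ n, π (evalDual n) = U n := by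
  have hnorm : ∀ (φ : WeakDual.characterSpace ℂ A) n, φ (U n) ∈ Submonoid.unitSphere ℂ := by
    intro φ n
    have h1 : star (φ (U n)) * φ (U n) = 1 := by
      rw [← map_star, ← map_mul, (hU n).1, map_one]
    have h2 : ‖φ (U n)‖ * ‖φ (U n)‖ = 1 := by
      rw [← CStarRing.norm_star_mul_self, h1, norm_one]
    refine mem_sphere_zero_iff_norm.2 ?_
    nlinarith [norm_nonneg (φ (U n))]
  let τ : C(WeakDual.characterSpace ℂ A, additiveDual R) :=
    { toFun := fun φ => ⟨fun n => ⟨φ (U n), hnorm φ n⟩, fun n m => Circle.ext (by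
        change φ (U (n + m)) = φ (U n) * φ (U m)
        rw [← hadd, map_mul])⟩
      continuous_toFun := by
        refine Continuous.subtype_mk (continuous_pi fun n => ?_) _
        exact Continuous.subtype_mk
          (map_continuous (WeakDual.gelfandTransform ℂ A (U n))) _ }
  refine ⟨((gelfandStarTransform A).symm : C(WeakDual.characterSpace ℂ A, ℂ) →⋆ₐ[ℂ] A).comp
    (ContinuousMap.compStarAlgHom' ℂ ℂ τ), fun n => ?_⟩
  change (gelfandStarTransform A).symm ((evalDual n).comp τ) = U n
  rw [← StarAlgEquiv.symm_apply_apply (gelfandStarTransform A) (U n)]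
  congr 1

/-- A unitary representation of the additive group of `R` extends to the continuous functions on
the dual group. -/
theorem exists_starAlgHom {A : Type*} [CStarAlgebra A] {U : R → A}
    (hU : ∀ n, U n ∈ unitary A) (hadd : ∀ n m, U n * U m = U (n + m)) :
    ∃ π : C(additiveDual R, ℂ) →⋆ₐ[ℂ] A, ∀ n, π (evalDual n) = U n := by
  have hc : ∀ n m, U n * U m = U m * U n := fun n m => by rw [hadd, hadd, add_comm]
  have h0 : U 0 = 1 := by
    have h := hadd 0 0
    rw [add_zero] at h
    calc U 0 = (star (U 0) * U 0) * U 0 := by rw [(hU 0).1, one_mul]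
      _ = 1 := by rw [mul_assoc, h, (hU 0).1]
  have hstar : ∀ n, star (U n) = U (-n) := fun n => by
    calc star (U n) = star (U n) * (U n * U (-n)) := by rw [hadd, add_neg_cancel, h0, mul_one]
      _ = U (-n) := by rw [← mul_assoc, (hU n).1, one_mul]
  have hcomm := StarAlgebra.isMulCommutative_adjoin ℂ (s := Set.range U)
    (by rintro _ ⟨n, rfl⟩ _ ⟨m, rfl⟩; exact hc n m)
    (by rintro _ ⟨n, rfl⟩ _ ⟨m, rfl⟩; rw [hstar]; exact hc _ _)
  -- The `U n` generate a commutative C*-algebra, which reduces to the previous case.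
  let B : StarSubalgebra ℂ A := (StarAlgebra.adjoin ℂ (Set.range U)).topologicalClosure
  let _ : CommRing B := StarSubalgebra.commRingTopologicalClosure _ hcomm.is_comm.comm
  have hB : IsClosed (B : Set A) := StarSubalgebra.isClosed_topologicalClosure _
  let _ : CStarAlgebra B := StarSubalgebra.cstarAlgebra B
  let _ : CommCStarAlgebra B := { mul_comm := fun a b => mul_comm a b }
  have hmem : ∀ n, U n ∈ B := fun n =>
    StarSubalgebra.le_topologicalClosure _ (StarAlgebra.subset_adjoin ℂ _ ⟨n, rfl⟩)
  obtain ⟨π, hπ⟩ := exists_starAlgHom_of_comm (A := B) (U := fun n => ⟨U n, hmem n⟩)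
    (fun n => ⟨Subtype.ext (hU n).1, Subtype.ext (hU n).2⟩)
    (fun n m => Subtype.ext (hadd n m))
  exact ⟨B.subtype.comp π, fun n => congrArg Subtype.val (hπ n)⟩

end Dual

/-! ### Isometric representations of `R` as covariant representations -/

section Translation

variable {R : Type u} [CommRing R]

/-- The functions satisfying covariance form a closed subalgebra. It contains the evaluations,
because `evalDual n` composed with the action of `r` is `evalDual (r * n)`. -/
theorem IsometricRep.exists_covariant (ρ : IsometricRep R) :
    ∃ π : C(additiveDual R, ℂ) →⋆ₐ[ℂ] (ρ.H →L[ℂ] ρ.H), (∀ n, π (evalDual n) = ρ.U n) ∧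
      ∀ (r : R⁰) (f : C(additiveDual R, ℂ)), ρ.S r * π f = π (f.comp (actionMap r)) * ρ.S r := by
  obtain ⟨π, hπ⟩ := exists_starAlgHom ρ.U_mem_unitary ρ.U_add
  have hcont : Continuous π :=
    AddMonoidHomClass.continuous_of_bound π 1 fun f => by
      rw [one_mul]
      exact NonUnitalStarAlgHom.norm_apply_le π f
  refine ⟨π, hπ, fun r f => ?_⟩
  refine mem_of_evalDual_mem (P :=
    { carrier := {f | ρ.S r * π f = π (f.comp (actionMap r)) * ρ.S r}
      mul_mem' := fun {f g} (hf : _ = _) (hg : _ = _) => by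
        change ρ.S r * π (f * g) = π (f.comp (actionMap r) * g.comp (actionMap r)) * ρ.S r
        rw [map_mul, map_mul, ← mul_assoc, hf, mul_assoc, hg, mul_assoc]
      add_mem' := fun {f g} (hf : _ = _) (hg : _ = _) => by
        change ρ.S r * π (f + g) = π (f.comp (actionMap r) + g.comp (actionMap r)) * ρ.S r
        rw [map_add, map_add, mul_add, add_mul, hf, hg]
      algebraMap_mem' := fun c => by
        change ρ.S r * π (algebraMap ℂ _ c) = π (algebraMap ℂ _ c) * ρ.S r
        rw [AlgHomClass.commutes, Algebra.commutes] }) ?_ (fun n => ?_) f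
  · exact isClosed_eq (continuous_const.mul hcont)
      ((hcont.comp (ContinuousMap.continuous_precomp _)).mul continuous_const)
  · change ρ.S r * π (evalDual n) = π (evalDual ((r : R) * n)) * ρ.S r
    rw [hπ, hπ, ρ.S_mul_U]

/-- The covariant representation that corresponds to an isometric representation. -/
noncomputable abbrev IsometricRep.toCovariantRep (ρ : IsometricRep R) :
    CovariantRep (additiveDual R) R⁰ where
  H := ρ.H
  π := ρ.exists_covariant.choose
  V := ρ.S
  V_isometry := ρ.S_isometry
  V_mul := fun s t => by rw [ρ.S_mul, mul_comm]
  covariance := ρ.exists_covariant.choose_spec.2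

theorem IsometricRep.toCovariantRep_π_evalDual (ρ : IsometricRep R) (n : R) :
    ρ.toCovariantRep.π (evalDual n) = ρ.U n :=
  ρ.exists_covariant.choose_spec.1 n

/-- The isometric representation that corresponds to a covariant representation. -/
noncomputable abbrev CovariantRep.toIsometricRep (κ : CovariantRep (additiveDual R) R⁰) :
    IsometricRep R where
  H := κ.H
  U := fun n => κ.π (evalDual n)
  S := κ.V
  U_mem_unitary := fun n => Unitary.map_mem κ.π (evalDual_mem_unitary n)
  S_isometry := κ.V_isometry
  S_mul := fun r t => by rw [κ.V_mul, mul_comm]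
  U_add := fun n m => by rw [← map_mul, evalDual_mul]
  S_mul_U := fun r n => κ.covariance r (evalDual n)

/-- Restriction along a map of index sets, as an algebra homomorphism. -/
noncomputable def restrictHom {ι κ : Type*} (H : ι → Type u) [∀ i, NormedAddCommGroup (H i)]
    [∀ i, InnerProductSpace ℂ (H i)] [∀ i, Nontrivial (H i)] (F : κ → ι) :
    BddOps H →ₐ[ℂ] BddOps (fun k => H (F k)) where
  toFun := restrict H F
  map_one' := restrict_one F
  map_mul' := restrict_mul F
  map_zero' := rfl
  map_add' _ _ := rfl
  commutes' _ := rfl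

theorem continuous_restrictHom {ι κ : Type*} (H : ι → Type u) [∀ i, NormedAddCommGroup (H i)]
    [∀ i, InnerProductSpace ℂ (H i)] [∀ i, Nontrivial (H i)] (F : κ → ι) :
    Continuous (restrictHom H F) := (restrict H F).continuous

variable (R) in
/-- The canonical homomorphism from isometric to covariant families of operators. -/
noncomputable def toCovariantFamily : BddOps (fun ρ : IsometricRep R => ρ.H) →ₐ[ℂ]
    BddOps (fun κ : CovariantRep (additiveDual R) R⁰ => κ.H) :=
  restrictHom (fun ρ : IsometricRep R => ρ.H) CovariantRep.toIsometricRep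

variable (R) in
/-- The canonical homomorphism from covariant to isometric families of operators. -/
noncomputable def toIsometricFamily : BddOps (fun κ : CovariantRep (additiveDual R) R⁰ => κ.H)
    →ₐ[ℂ] BddOps (fun ρ : IsometricRep R => ρ.H) :=
  restrictHom (fun κ : CovariantRep (additiveDual R) R⁰ => κ.H) IsometricRep.toCovariantRep

theorem continuous_toCovariantFamily : Continuous (toCovariantFamily R) :=
  continuous_restrictHom (fun ρ : IsometricRep R => ρ.H) CovariantRep.toIsometricRep

theorem continuous_toIsometricFamily : Continuous (toIsometricFamily R) :=
  continuous_restrictHom (fun κ : CovariantRep (additiveDual R) R⁰ => κ.H)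
    IsometricRep.toCovariantRep

theorem toIsometricFamily_univFun_evalDual (n : R) :
    toIsometricFamily R (univFun (additiveDual R) R⁰ (evalDual n)) = univU R n :=
  lp.ext <| funext fun ρ => ρ.toCovariantRep_π_evalDual n

variable (R) in
/-- The map `f ↦ univFun f`, as an algebra homomorphism. -/
noncomputable def univFunHom : C(additiveDual R, ℂ) →ₐ[ℂ]
    BddOps (fun κ : CovariantRep (additiveDual R) R⁰ => κ.H) where
  toFun := univFun (additiveDual R) R⁰
  map_one' := univFun_one
  map_mul' := univFun_mul
  map_zero' := lp.ext <| funext fun κ => map_zero κ.π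
  map_add' f g := lp.ext <| funext fun κ => map_add κ.π f g
  commutes' c := lp.ext <| funext fun κ => AlgHomClass.commutes κ.π c

theorem continuous_univFunHom : Continuous (univFunHom R) :=
  AddMonoidHomClass.continuous_of_bound (univFunHom R) 1 fun f => by
    rw [one_mul]
    exact lp.norm_le_of_forall_le (norm_nonneg f) fun κ =>
      NonUnitalStarAlgHom.norm_apply_le κ.π f

theorem univFun_mem_semicrossedProduct (f : C(additiveDual R, ℂ)) :
    univFun (additiveDual R) R⁰ f ∈ semicrossedProduct (additiveDual R) R⁰ :=
  Subalgebra.le_topologicalClosure _ (Algebra.subset_adjoin (Or.inl ⟨f, rfl⟩))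

theorem univIsom_mem_semicrossedProduct (r : R⁰) :
    univIsom (additiveDual R) R⁰ r ∈ semicrossedProduct (additiveDual R) R⁰ :=
  Subalgebra.le_topologicalClosure _ (Algebra.subset_adjoin (Or.inr ⟨r, rfl⟩))

/-- Closed subalgebras that contain the generators contain `A(R)`. -/
theorem domainAlgebra_le {P : Subalgebra ℂ (BddOps (fun ρ : IsometricRep R => ρ.H))}
    (hP : IsClosed (P : Set (BddOps (fun ρ : IsometricRep R => ρ.H))))
    (hU : ∀ n, univU R n ∈ P) (hS : ∀ r, univS R r ∈ P) : domainAlgebra R ≤ P := by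
  refine Subalgebra.topologicalClosure_minimal (Algebra.adjoin_le ?_) hP
  rintro _ (⟨n, rfl⟩ | ⟨r, rfl⟩)
  exacts [hU n, hS r]

/-- Closed subalgebras that contain the evaluations and the isometries contain the semicrossed
product of the dual. -/
theorem semicrossedProduct_additiveDual_le
    {P : Subalgebra ℂ (BddOps (fun κ : CovariantRep (additiveDual R) R⁰ => κ.H))}
    (hP : IsClosed (P : Set (BddOps (fun κ : CovariantRep (additiveDual R) R⁰ => κ.H))))
    (hU : ∀ n, univFun (additiveDual R) R⁰ (evalDual n) ∈ P)
    (hS : ∀ r, univIsom (additiveDual R) R⁰ r ∈ P) :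
    semicrossedProduct (additiveDual R) R⁰ ≤ P := by
  refine Subalgebra.topologicalClosure_minimal (Algebra.adjoin_le ?_) hP
  rintro _ (⟨f, rfl⟩ | ⟨r, rfl⟩)
  · exact mem_of_evalDual_mem (P := P.comap (univFunHom R))
      (hP.preimage continuous_univFunHom) hU f
  · exact hS r

theorem isClosed_domainAlgebra :
    IsClosed (domainAlgebra R : Set (BddOps (fun ρ : IsometricRep R => ρ.H))) :=
  Subalgebra.isClosed_topologicalClosure _

theorem isClosed_semicrossedProduct :
    IsClosed (semicrossedProduct (additiveDual R) R⁰ :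
      Set (BddOps (fun κ : CovariantRep (additiveDual R) R⁰ => κ.H))) :=
  Subalgebra.isClosed_topologicalClosure _

theorem domainAlgebra_le_comap :
    domainAlgebra R ≤ (semicrossedProduct (additiveDual R) R⁰).comap (toCovariantFamily R) :=
  domainAlgebra_le (isClosed_semicrossedProduct.preimage continuous_toCovariantFamily)
    (fun n => univFun_mem_semicrossedProduct (evalDual n))
    (fun r => univIsom_mem_semicrossedProduct r)

theorem semicrossedProduct_le_comap :
    semicrossedProduct (additiveDual R) R⁰ ≤ (domainAlgebra R).comap (toIsometricFamily R) :=
  semicrossedProduct_additiveDual_le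
    (isClosed_domainAlgebra.preimage continuous_toIsometricFamily)
    (fun n => by
      rw [Subalgebra.mem_comap, toIsometricFamily_univFun_evalDual]
      exact univU_mem n)
    (fun r => univS_mem r)

/-- Since `π` is obtained by choice, the identity is checked on generators and extended by
continuity. -/
theorem toIsometricFamily_toCovariantFamily {a : BddOps (fun ρ : IsometricRep R => ρ.H)}
    (ha : a ∈ domainAlgebra R) : toIsometricFamily R (toCovariantFamily R a) = a :=
  domainAlgebra_le
    (P := AlgHom.equalizer ((toIsometricFamily R).comp (toCovariantFamily R)) (AlgHom.id ℂ _))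
    (isClosed_eq (continuous_toIsometricFamily.comp continuous_toCovariantFamily) continuous_id)
    (fun n => toIsometricFamily_univFun_evalDual n) (fun _ => rfl) ha

theorem toCovariantFamily_toIsometricFamily
    {b : BddOps (fun κ : CovariantRep (additiveDual R) R⁰ => κ.H)}
    (hb : b ∈ semicrossedProduct (additiveDual R) R⁰) :
    toCovariantFamily R (toIsometricFamily R b) = b :=
  semicrossedProduct_additiveDual_le
    (P := AlgHom.equalizer ((toCovariantFamily R).comp (toIsometricFamily R)) (AlgHom.id ℂ _))
    (isClosed_eq (continuous_toCovariantFamily.comp continuous_toIsometricFamily) continuous_id)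
    (fun n => congrArg (toCovariantFamily R) (toIsometricFamily_univFun_evalDual n))
    (fun _ => rfl) hb

theorem exists_algEquiv_of_inverse {A' B' : Type*} [Ring A'] [Ring B'] [Algebra ℂ A']
    [Algebra ℂ B'] {A : Subalgebra ℂ A'} {B : Subalgebra ℂ B'} {φ : A' →ₐ[ℂ] B'}
    {ψ : B' →ₐ[ℂ] A'} (hφ : A ≤ B.comap φ) (hψ : B ≤ A.comap ψ)
    (h₁ : ∀ {a}, a ∈ A → ψ (φ a) = a) (h₂ : ∀ {b}, b ∈ B → φ (ψ b) = b) :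
    ∃ e : A ≃ₐ[ℂ] B, ∀ a, (e a : B') = φ a :=
  ⟨AlgEquiv.ofAlgHom ((φ.comp A.val).codRestrict B fun a => hφ a.2)
    ((ψ.comp B.val).codRestrict A fun b => hψ b.2)
    (AlgHom.ext fun b => Subtype.ext (h₂ b.2)) (AlgHom.ext fun a => Subtype.ext (h₁ a.2)),
    fun _ => rfl⟩

variable (R) in
/-- `A(R)` is the semicrossed product of the dual of `R` by the multiplicative monoid. -/
theorem completelyIsometricallyIsomorphic_additiveDual :
    CompletelyIsometricallyIsomorphic (domainAlgebra R)
      (semicrossedProduct (additiveDual R) R⁰) := by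
  obtain ⟨e, he⟩ := exists_algEquiv_of_inverse (domainAlgebra_le_comap (R := R))
    semicrossedProduct_le_comap
    toIsometricFamily_toCovariantFamily toCovariantFamily_toIsometricFamily
  refine ⟨e, fun n a => ?_⟩
  simp only [he]
  -- Both the map and its inverse restrict families along a map of representations, so both are
  -- completely contractive.
  refine le_antisymm (matrixNorm_restrict_le (H := fun ρ : IsometricRep R => ρ.H)
    (fun κ : CovariantRep (additiveDual R) R⁰ => κ.toIsometricRep) _) ?_
  have h := matrixNorm_restrict_le (H := fun κ : CovariantRep (additiveDual R) R⁰ => κ.H)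
    (fun ρ : IsometricRep R => ρ.toCovariantRep)
    (fun j k => toCovariantFamily R (a j k) : Matrix (Fin n) (Fin n) (BddOps _))
  refine le_trans (le_of_eq ?_) h
  exact congrArg matrixNorm (funext fun j => funext fun k =>
    (toIsometricFamily_toCovariantFamily (a j k).2).symm)

end Translation

end IntDomAlg


theorem proposition7 (R : Type u) [CommRing R] [IsDomain R] :
    ((∃ (X S : Type u) (_ : TopologicalSpace X) (_ : CompactSpace X) (_ : T2Space X)
        (_ : Monoid S) (_ : MulAction S X) (_ : ContinuousConstSMul S X),
        IntDomAlg.EmbedsInAmenableGroup S ∧ (∀ s : S, IsUnit s → s = 1) ∧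
        IntDomAlg.CompletelyIsometricallyIsomorphic
          (IntDomAlg.domainAlgebra R) (IntDomAlg.semicrossedProduct X S)) ↔
      ∀ x : R, IsUnit x → x = 1) ∧
    ((∀ x : R, IsUnit x → x = 1) → ¬ IsField R →
      ¬ Monoid.FG (IntDomAlg.unitQuotient R)) := by
  refine ⟨⟨?_, fun hU => ?_⟩, IntDomAlg.not_fg_unitQuotient R⟩
  · rintro ⟨X, S, _, _, _, _, _, _, hemb, hS, hiso⟩ x hx
    exact IntDomAlg.eq_one_of_isUnit hemb hS hiso hx
  · exact ⟨IntDomAlg.additiveDual R, R⁰, inferInstance, inferInstance, inferInstance,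
      inferInstance, inferInstance, inferInstance,
      IntDomAlg.embedsInAmenableGroup_nonZeroDivisors R,
      fun s hs => Subtype.ext (hU _ (hs.map R⁰.subtype)),
      IntDomAlg.completelyIsometricallyIsomorphic_additiveDual R⟩
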